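/- Let $m\ge 1$ and let $D=\{d_1,\dots,d_m\}$ be a set of real digits with $0=d_1<d_2<\dots<d_m$. For $0<\lambda<1$ let $\nu_\lambda$ be the natural self-similar measure of the system $\psi_i(x)=\lambda x+d_i$, i.e. the unique Borel probability measure on $\mathbb{R}$ with $\nu_\lambda=\sum_{i=1}^m\frac1m\,\nu_\lambda\circ\psi_i^{-1}$ (equivalently, the distribution of $\sum_{n\ge0}a_n\lambda^n$ with $a_n$ independent and uniform on $D$). For $0<\gamma,\lambda<1$ let $K_{\gamma,\lambda}\subset\mathbb{R}^2$ be the attractor of the system $\phi_i(x,y)=(\gamma x+d_i,\lambda y+d_i)$, $1\le i\le m$. Let $\mathcal{B}$ be the set of power series $\sum_{n\ge 0}c_nx^n$ with all $c_n\in D-D$ and $c_0\neq0$; a double root of $f\in\mathcal B$ is a point $x\in(-1,1)$ with $f(x)=f'(x)=0$. The lower correlation dimension of a Borel probability measure $\nu$ on $\mathbb{R}$ is $$\underline{\dim}_2(\nu)=\liminf_{r\to0^+}\frac{\log\big((\nu\times\nu)\{(x,y):|x-y|\le r\}\big)}{\log r}.$$ Put $\Gamma(0,1/m)=\{(\gamma,\lambda)\in(0,1)^2:\gamma<\lambda,\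 1/m<\lambda,\ 0<\gamma\lambda<1/m\}$. Assume that: 1. $I\subset(1/m,1)$ is an open interval such that $\underline{\dim}_2(\nu_\lambda)=1$ for Lebesgue-almost every $\lambda\in I$; 2. $J\subset(0,1)$ is an open interval such that no $f\in\mathcal{B}$ has a double root in $J$; 3. $R\subset\mathbb{R}^2$ is an open set such that for no $(\gamma,\lambda)\in R$ and $f\in\mathcal{B}$ are $\gamma$ and $\lambda$ both double roots of $f$. Let $\mathcal S_1=R\cap(I\times I)\cap\Gamma(0,1/m)$, $\mathcal S_2=(J\times I)\cap\Gamma(0,1/m)$ and $\mathcal S=\mathcal S_1\cup\mathcal S_2$. Then for Lebesgue-almost every $(\gamma,\lambda)\in\mathcal S$ the box-counting dimension of $K_{\gamma,\lambda}$ exists and $$\dim_H(K_{\gamma,\lambda})=\dim_B(K_{\gamma,\lambda})=1+\frac{\log(m\lambda)}{\log(1/\gamma)}.$$ -/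

import Mathlib

open MeasureTheory Filter Topology
open scoped NNReal Pointwise

namespace SelfAffine

noncomputable section

/-- The difference set `D - D` of the digit set `D = {d 0, …, d (m-1)}`. -/
def digitDiff {m : ℕ} (d : Fin m → ℝ) : Set ℝ := Set.range d - Set.range d

/-- The sum `∑ c n * x ^ n` of the power series with coefficients `c`. -/
def seriesSum (c : ℕ → ℝ) (x : ℝ) : ℝ := ∑' n, c n * x ^ n

/-- The class of power series with coefficients in `D - D` and non-zero constant term,
represented by their coefficient sequences. -/
def powerSeriesClass {m : ℕ} (d : Fin m → ℝ) : Set (ℕ → ℝ) :=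
  {c | (∀ n, c n ∈ digitDiff d) ∧ c 0 ≠ 0}

/-- `x` is a double root (a root of multiplicity at least two) of the power series with
coefficients `c`. All the series considered have bounded coefficients, hence converge on
`(-1, 1)`, and only points of this interval count as roots. -/
def IsDoubleRoot (c : ℕ → ℝ) (x : ℝ) : Prop :=
  |x| < 1 ∧ seriesSum c x = 0 ∧ HasDerivAt (seriesSum c) 0 x

/-- The uniform Bernoulli measure `(1/m, …, 1/m)^ℕ` on the sequence space. -/
def uniformBernoulli (m : ℕ) [NeZero m] : Measure (ℕ → Fin m) :=
  Measure.infinitePi fun _ => (PMF.uniformOfFintype (Fin m)).toMeasure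

/-- The projection `Π_x`, sending a digit sequence `ω` to `∑ d (ω n) * x ^ n`. -/
def proj {m : ℕ} (d : Fin m → ℝ) (x : ℝ) (ω : ℕ → Fin m) : ℝ :=
  seriesSum (fun n => d (ω n)) x

/-- The natural self-similar measure `ν_x` of the system `{t ↦ x * t + d i}`: the image of the
uniform Bernoulli measure under `Π_x`. -/
def selfSimilarMeasure {m : ℕ} [NeZero m] (d : Fin m → ℝ) (x : ℝ) : Measure ℝ :=
  (uniformBernoulli m).map (proj d x)

/-- The planar affine map `φ_i (x, y) = (γ x + d_i, l y + d_i)`. -/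
def affineMap {m : ℕ} (d : Fin m → ℝ) (γ l : ℝ) (i : Fin m) (p : EuclideanSpace ℝ (Fin 2)) :
    EuclideanSpace ℝ (Fin 2) :=
  !₂[γ * p 0 + d i, l * p 1 + d i]

/-- The attractor `K_{γ,l}` of the system `{φ_i}`, as the set of all points
`(Π_γ ω, Π_l ω)`. -/
def attractor {m : ℕ} (d : Fin m → ℝ) (γ l : ℝ) : Set (EuclideanSpace ℝ (Fin 2)) :=
  Set.range fun ω : ℕ → Fin m => !₂[proj d γ ω, proj d l ω]

/-- The lower correlation dimension of a Borel measure on the line,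
`liminf_{r → 0+} log ((ν × ν) {(x, y) : |x - y| ≤ r}) / log r`. -/
def lowerCorrelationDim (ν : Measure ℝ) : EReal :=
  liminf (fun r : ℝ =>
    ENNReal.log ((ν.prod ν) {p : ℝ × ℝ | |p.1 - p.2| ≤ r}) / ((Real.log r : ℝ) : EReal)) (𝓝[>] 0)

/-- The box-counting dimension of the bounded set `A` exists and is equal to `s`: with `N(r)` the
least number of closed balls of radius `r` that cover `A`, `log N(r) / log (1/r) → s` as
`r → 0+`. -/
def HasBoxDim {X : Type*} [PseudoMetricSpace X] (A : Set X) (s : ℝ) : Prop :=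
  TotallyBounded A ∧
    Tendsto (fun r : ℝ≥0 =>
      Real.log ((Metric.externalCoveringNumber r A).toNat : ℝ) / Real.log (1 / (r : ℝ)))
      (𝓝[>] 0) (𝓝 s)

/-- `Δ = {(γ, l) ∈ (0,1)² : γ < l, 1/m < l}`. -/
def regionDelta (m : ℕ) : Set (ℝ × ℝ) :=
  {p | p.1 ∈ Set.Ioo 0 1 ∧ p.2 ∈ Set.Ioo 0 1 ∧ p.1 < p.2 ∧ 1 / (m : ℝ) < p.2}

/-- `Γ(a, b) = {(γ, l) ∈ Δ : γ * l ∈ (a, b)}`. -/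
def regionGamma (m : ℕ) (a b : ℝ) : Set (ℝ × ℝ) :=
  {p | p ∈ regionDelta m ∧ p.1 * p.2 ∈ Set.Ioo a b}

/-! ### The attractor and the measure are the ones determined by the iterated function systems -/

/-- Prepend the symbol `i` to the sequence `ω`. -/
def prepend {m : ℕ} (i : Fin m) (ω : ℕ → Fin m) (n : ℕ) : Fin m :=
  Nat.casesOn n i ω

theorem exists_bound {m : ℕ} (d : Fin m → ℝ) : ∃ C, ∀ i, |d i| ≤ C := by
  obtain ⟨C, hC⟩ := (Set.finite_range fun i => |d i|).bddAbove
  exact ⟨C, fun i => hC ⟨i, rfl⟩⟩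

theorem summable_bound (C : ℝ) {x : ℝ} (hx : |x| < 1) : Summable fun n : ℕ => C * |x| ^ n :=
  (summable_geometric_of_lt_one (abs_nonneg x) hx).mul_left C

theorem term_bound {m : ℕ} (d : Fin m → ℝ) {C : ℝ} (hC : ∀ i, |d i| ≤ C) (x : ℝ)
    (n : ℕ) (ω : ℕ → Fin m) : ‖d (ω n) * x ^ n‖ ≤ C * |x| ^ n := by
  rw [Real.norm_eq_abs, abs_mul, abs_pow]
  exact mul_le_mul_of_nonneg_right (hC _) (by positivity)

theorem continuous_proj {m : ℕ} (d : Fin m → ℝ) {x : ℝ} (hx : |x| < 1) :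
    Continuous (proj d x) := by
  obtain ⟨C, hC⟩ := exists_bound d
  refine continuous_tsum (u := fun n => C * |x| ^ n) (fun n => ?_) (summable_bound C hx)
    fun n ω => term_bound d hC x n ω
  exact (continuous_of_discreteTopology.comp (continuous_apply n)).mul continuous_const

theorem proj_prepend {m : ℕ} (d : Fin m → ℝ) {x : ℝ} (hx : |x| < 1) (i : Fin m)
    (ω : ℕ → Fin m) : proj d x (prepend i ω) = x * proj d x ω + d i := by
  obtain ⟨C, hC⟩ := exists_bound d
  have hs := Summable.of_norm_bounded (summable_bound C hx)
    fun n => term_bound d hC x n (prepend i ω)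
  unfold proj seriesSum
  rw [hs.tsum_eq_zero_add, ← tsum_mul_left, add_comm]
  congr 1
  · refine tsum_congr fun n => ?_
    simp only [prepend]
    ring
  · simp [prepend]

theorem affineMap_contracts {m : ℕ} (d : Fin m → ℝ) {γ l : ℝ} (i : Fin m)
    (p q : EuclideanSpace ℝ (Fin 2)) :
    dist (affineMap d γ l i p) (affineMap d γ l i q) ≤ max |γ| |l| * dist p q := by
  have h0 : 0 ≤ max |γ| |l| := le_max_of_le_left (abs_nonneg _)
  rw [EuclideanSpace.dist_eq, EuclideanSpace.dist_eq]
  refine Real.sqrt_le_iff.2 ⟨by positivity, ?_⟩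
  rw [mul_pow, Real.sq_sqrt (by positivity), Finset.mul_sum]
  refine Finset.sum_le_sum fun j _ => ?_
  rw [← mul_pow]
  refine pow_le_pow_left₀ dist_nonneg ?_ 2
  fin_cases j
  · simp only [affineMap, Real.dist_eq]
    simp only [Fin.zero_eta, Matrix.cons_val_zero]
    rw [show γ * p 0 + d i - (γ * q 0 + d i) = γ * (p 0 - q 0) by ring, abs_mul]
    exact mul_le_mul_of_nonneg_right (le_max_left _ _) (abs_nonneg _)
  · simp only [affineMap, Real.dist_eq]
    simp only [Fin.mk_one, Matrix.cons_val_one, Matrix.cons_val_fin_one]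
    rw [show l * p 1 + d i - (l * q 1 + d i) = l * (p 1 - q 1) by ring, abs_mul]
    exact mul_le_mul_of_nonneg_right (le_max_right _ _) (abs_nonneg _)

/-- A compact invariant set is contained in every non-empty compact invariant set. -/
theorem invariant_subset {m : ℕ} (d : Fin m → ℝ) {γ l : ℝ} (hγ : |γ| < 1) (hl : |l| < 1)
    {K L : Set (EuclideanSpace ℝ (Fin 2))} (hK : IsCompact K) (hL : IsCompact L)
    (hLne : L.Nonempty) (hKi : K = ⋃ i, affineMap d γ l i '' K)
    (hLi : L = ⋃ i, affineMap d γ l i '' L) : K ⊆ L := by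
  rcases K.eq_empty_or_nonempty with rfl | hKne
  · exact Set.empty_subset _
  obtain ⟨x, hxK, hmax⟩ :=
    hK.exists_isMaxOn hKne (Metric.continuous_infDist_pt L).continuousOn
  have hx := hxK
  rw [hKi] at hx
  obtain ⟨i, y, hy, rfl⟩ := Set.mem_iUnion.1 hx
  obtain ⟨z, hz, hyz⟩ := hL.exists_infDist_eq_dist hLne y
  have hzL : affineMap d γ l i z ∈ L := by
    rw [hLi]
    exact Set.mem_iUnion.2 ⟨i, z, hz, rfl⟩
  have h1 := Metric.infDist_le_dist_of_mem (x := affineMap d γ l i y) hzL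
  have h2 := affineMap_contracts d (γ := γ) (l := l) i y z
  have h3 : Metric.infDist y L ≤ Metric.infDist (affineMap d γ l i y) L := hmax hy
  have h4 : max |γ| |l| < 1 := max_lt hγ hl
  have h5 : 0 ≤ max |γ| |l| := le_max_of_le_left (abs_nonneg _)
  have h6 : 0 ≤ Metric.infDist y L := Metric.infDist_nonneg
  have h7 : Metric.infDist (affineMap d γ l i y) L ≤ 0 := by
    rw [← hyz] at h2
    nlinarith
  intro w hw
  have h8 : Metric.infDist w L ≤ Metric.infDist (affineMap d γ l i y) L := hmax hw
  rw [hL.isClosed.mem_iff_infDist_zero hLne]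
  exact le_antisymm (h8.trans h7) Metric.infDist_nonneg

/-- `attractor d γ l` is the unique non-empty compact set `K` with `K = ⋃ i, φ_i(K)`. -/
theorem eq_attractor_iff {m : ℕ} [NeZero m] (d : Fin m → ℝ) {γ l : ℝ} (hγ : |γ| < 1)
    (hl : |l| < 1) (K : Set (EuclideanSpace ℝ (Fin 2))) :
    K = attractor d γ l ↔
      IsCompact K ∧ K.Nonempty ∧ K = ⋃ i, affineMap d γ l i '' K := by
  have hc : IsCompact (attractor d γ l) := by
    refine isCompact_range ?_
    refine (PiLp.continuous_toLp 2 _).comp (continuous_pi fun j => ?_)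
    fin_cases j
    · exact continuous_proj d hγ
    · exact continuous_proj d hl
  have hne : (attractor d γ l).Nonempty := Set.range_nonempty _
  have key (i : Fin m) (ω : ℕ → Fin m) :
      affineMap d γ l i !₂[proj d γ ω, proj d l ω] =
        !₂[proj d γ (prepend i ω), proj d l (prepend i ω)] := by
    simp [affineMap, proj_prepend d hγ, proj_prepend d hl]
  have hi : attractor d γ l = ⋃ i, affineMap d γ l i '' attractor d γ l := by
    ext p
    simp only [Set.mem_iUnion]
    constructor
    · rintro ⟨ω, rfl⟩
      refine ⟨ω 0, _, ⟨fun n => ω (n + 1), rfl⟩, ?_⟩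
      have hω : prepend (ω 0) (fun n => ω (n + 1)) = ω := by
        funext n
        cases n <;> rfl
      simp only [key, hω]
    · rintro ⟨i, _, ⟨ω, rfl⟩, rfl⟩
      exact ⟨prepend i ω, (key i ω).symm⟩
  constructor
  · rintro rfl
    exact ⟨hc, hne, hi⟩
  · rintro ⟨h1, h2, h3⟩
    exact (invariant_subset d hγ hl h1 hc hne h3 hi).antisymm
      (invariant_subset d hγ hl hc h1 h2 hi h3)

instance {m : ℕ} [NeZero m] : IsProbabilityMeasure (uniformBernoulli m) := by
  unfold uniformBernoulli
  infer_instance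

theorem measurable_prepend {m : ℕ} (i : Fin m) : Measurable (prepend i) := by
  refine measurable_pi_lambda _ fun n => ?_
  cases n with
  | zero => exact measurable_const
  | succ n => exact measurable_pi_apply n

theorem uniformBernoulli_eq_sum (m : ℕ) [NeZero m] :
    uniformBernoulli m =
      ∑ i : Fin m, (m : ENNReal)⁻¹ • (uniformBernoulli m).map (prepend i) := by
  symm
  classical
  refine Measure.eq_infinitePi _ fun s t ht => ?_
  set P : Measure (Fin m) := (PMF.uniformOfFintype (Fin m)).toMeasure with hP
  set u : ℕ → Set (Fin m) := fun n => if n ∈ s then t n else Set.univ with hu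
  have hum (n : ℕ) : MeasurableSet (u n) := MeasurableSet.of_discrete
  obtain ⟨N, hN⟩ : ∃ N, ∀ n ∈ s, n < N + 1 :=
    ⟨s.sup id, fun n hn => Nat.lt_succ_of_le (Finset.le_sup (f := id) hn)⟩
  have hbox : Set.pi (s : Set ℕ) t = Set.pi (Finset.range (N + 1) : Set ℕ) u := by
    ext ω
    simp only [Set.mem_pi, Finset.mem_coe, Finset.mem_range, hu]
    constructor
    · intro h n _
      split_ifs with hn
      · exact h n hn
      · trivial
    · intro h n hn
      simpa [hn] using h n (hN n hn)
  have hprod : ∏ n ∈ s, P (t n) = ∏ n ∈ Finset.range (N + 1), P (u n) := by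
    rw [← Finset.prod_subset (s₁ := s) (fun n hn => Finset.mem_range.2 (hN n hn))]
    · exact Finset.prod_congr rfl fun n hn => by simp [hu, hn]
    · intro n _ hn
      simp [hu, hn]
  have hmb : MeasurableSet (Set.pi (Finset.range (N + 1) : Set ℕ) u) :=
    MeasurableSet.pi (Finset.countable_toSet _) fun n _ => hum n
  have hpre (i : Fin m) : (uniformBernoulli m).map (prepend i)
      (Set.pi (Finset.range (N + 1) : Set ℕ) u) =
      (u 0).indicator 1 i * ∏ n ∈ Finset.range N, P (u (n + 1)) := by
    rw [Measure.map_apply (measurable_prepend i) hmb]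
    by_cases hi : i ∈ u 0
    · have : prepend i ⁻¹' Set.pi (Finset.range (N + 1) : Set ℕ) u =
          Set.pi (Finset.range N : Set ℕ) fun n => u (n + 1) := by
        ext ω
        simp only [Set.mem_preimage, Set.mem_pi, Finset.mem_coe, Finset.mem_range]
        constructor
        · intro h n hn
          exact h (n + 1) (by omega)
        · intro h n hn
          cases n with
          | zero => exact hi
          | succ n => exact h n (by omega)
      rw [this, uniformBernoulli, Measure.infinitePi_pi _ fun n _ => hum (n + 1)]
      simp [hi, hP]
    · have : prepend i ⁻¹' Set.pi (Finset.range (N + 1) : Set ℕ) u = ∅ := by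
        ext ω
        simp only [Set.mem_preimage, Set.mem_pi, Finset.mem_coe, Finset.mem_range,
          Set.mem_empty_iff_false, iff_false]
        intro h
        exact hi (h 0 (by omega))
      rw [this, measure_empty, Set.indicator_of_notMem hi, zero_mul]
  have hP0 : P (u 0) = ∑ i, (m : ENNReal)⁻¹ * (u 0).indicator 1 i := by
    rw [hP, PMF.toMeasure_apply_fintype]
    refine Finset.sum_congr rfl fun i _ => ?_
    by_cases hi : i ∈ u 0 <;> simp [hi]
  rw [hprod, hbox, Finset.prod_range_succ', hP0, Finset.mul_sum]
  simp only [Measure.coe_finsetSum, Measure.coe_smul, Finset.sum_apply, Pi.smul_apply,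
    smul_eq_mul, hpre]
  refine Finset.sum_congr rfl fun i _ => ?_
  ring

theorem measurable_proj {m : ℕ} (d : Fin m → ℝ) {x : ℝ} (hx : |x| < 1) :
    Measurable (proj d x) := (continuous_proj d hx).measurable

theorem invariant_charFun {m : ℕ} (d : Fin m → ℝ) {x : ℝ}
    {ν : Measure ℝ} [IsProbabilityMeasure ν]
    (hν : ν = ∑ i, (m : ENNReal)⁻¹ • ν.map fun t => x * t + d i) (t : ℝ) :
    charFun ν t = ((m : ℂ)⁻¹ * ∑ i, Complex.exp (t * d i * Complex.I)) * charFun ν (x * t) := by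
  have hint (μ : Measure ℝ) [IsProbabilityMeasure μ] :
      Integrable (fun y : ℝ => Complex.exp (t * y * Complex.I)) μ := by
    refine Integrable.of_bound (by fun_prop) 1 (ae_of_all _ fun y => ?_)
    rw [← Complex.ofReal_mul, Complex.norm_exp_ofReal_mul_I]
  have hmap (i : Fin m) : IsProbabilityMeasure (ν.map fun t => x * t + d i) :=
    Measure.isProbabilityMeasure_map (by fun_prop)
  have hsm (i : Fin m) : ∫ y, Complex.exp (t * y * Complex.I) ∂(ν.map fun t => x * t + d i) =
      Complex.exp (t * d i * Complex.I) * charFun ν (x * t) := by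
    rw [integral_map (by fun_prop) (by fun_prop), charFun_apply_real, ← integral_const_mul]
    congr 1
    funext y
    rw [← Complex.exp_add]
    push_cast
    ring_nf
  have hm : m ≠ 0 := by
    rintro rfl
    simp only [Finset.univ_eq_empty, Finset.sum_empty] at hν
    exact IsProbabilityMeasure.ne_zero ν hν
  conv_lhs => rw [charFun_apply_real, hν]
  rw [integral_finsetSum_measure fun i _ =>
    (hint (ν.map fun t => x * t + d i)).smul_measure (by simp [hm])]
  simp only [integral_smul_measure, hsm, ENNReal.toReal_inv, ENNReal.toReal_natCast]
  rw [← Finset.smul_sum, ← Finset.sum_mul, Complex.real_smul]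
  push_cast
  ring

theorem invariant_unique {m : ℕ} (d : Fin m → ℝ) {x : ℝ} (hx : |x| < 1)
    {μ ν : Measure ℝ} [IsProbabilityMeasure μ] [IsProbabilityMeasure ν]
    (hμ : μ = ∑ i, (m : ENNReal)⁻¹ • μ.map fun t => x * t + d i)
    (hν : ν = ∑ i, (m : ENNReal)⁻¹ • ν.map fun t => x * t + d i) : μ = ν := by
  refine Measure.ext_of_charFun (funext fun t => ?_)
  have hstep (s : ℝ) : ‖charFun μ s - charFun ν s‖ ≤
      ‖charFun μ (x * s) - charFun ν (x * s)‖ := by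
    rw [invariant_charFun d hμ s, invariant_charFun d hν s, ← mul_sub, norm_mul]
    refine mul_le_of_le_one_left (norm_nonneg _) ?_
    rw [norm_mul]
    have h1 : ‖∑ i, Complex.exp (s * d i * Complex.I)‖ ≤ m := by
      refine (norm_sum_le _ _).trans (le_of_eq ?_)
      have (i : Fin m) : ‖Complex.exp (s * d i * Complex.I)‖ = 1 := by
        rw [← Complex.ofReal_mul, Complex.norm_exp_ofReal_mul_I]
      simp [this]
    rw [norm_inv, Complex.norm_natCast]
    exact inv_mul_le_one_of_le₀ h1 (by positivity)
  have hiter (n : ℕ) : ‖charFun μ t - charFun ν t‖ ≤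
      ‖charFun μ (x ^ n * t) - charFun ν (x ^ n * t)‖ := by
    induction n with
    | zero => simp
    | succ n ih =>
      refine ih.trans ((hstep _).trans (le_of_eq ?_))
      rw [pow_succ']
      ring_nf
  have hlim : Tendsto (fun n : ℕ => ‖charFun μ (x ^ n * t) - charFun ν (x ^ n * t)‖) atTop
      (𝓝 0) := by
    have h0 : Tendsto (fun n : ℕ => x ^ n * t) atTop (𝓝 0) := by
      simpa using (tendsto_pow_atTop_nhds_zero_of_abs_lt_one hx).mul_const t
    have hcont : Continuous fun s : ℝ => ‖charFun μ s - charFun ν s‖ :=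
      (continuous_charFun.sub continuous_charFun).norm
    have h1 := (hcont.tendsto 0).comp h0
    simp only [charFun_zero, probReal_univ, sub_self, norm_zero] at h1
    exact h1
  have := ge_of_tendsto' hlim hiter
  exact sub_eq_zero.1 (norm_le_zero_iff.1 this)

/-- `selfSimilarMeasure d x` is the unique Borel probability measure `ν` on the line with
`ν = ∑ i, (1/m) (ν ∘ ψ_i⁻¹)`, where `ψ_i t = x * t + d i`. -/
theorem eq_selfSimilarMeasure_iff {m : ℕ} [NeZero m] (d : Fin m → ℝ) {x : ℝ} (hx : |x| < 1)
    (ν : Measure ℝ) :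
    ν = selfSimilarMeasure d x ↔
      IsProbabilityMeasure ν ∧
        ν = ∑ i, (m : ENNReal)⁻¹ • ν.map fun t => x * t + d i := by
  have hp : IsProbabilityMeasure (selfSimilarMeasure d x) :=
    Measure.isProbabilityMeasure_map (measurable_proj d hx).aemeasurable
  have hs : selfSimilarMeasure d x =
      ∑ i, (m : ENNReal)⁻¹ • (selfSimilarMeasure d x).map fun t => x * t + d i := by
    conv_lhs => rw [selfSimilarMeasure, uniformBernoulli_eq_sum m,
      Measure.map_finset_sum (measurable_proj d hx).aemeasurable]
    refine Finset.sum_congr rfl fun i _ => ?_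
    rw [Measure.map_smul, Measure.map_map (measurable_proj d hx) (measurable_prepend i),
      selfSimilarMeasure, Measure.map_map (by fun_prop) (measurable_proj d hx)]
    congr 2
    funext ω
    exact proj_prepend d hx i ω
  constructor
  · rintro rfl
    exact ⟨hp, hs⟩
  · rintro ⟨h1, h2⟩
    exact invariant_unique d hx h2 hs

end

end SelfAffine

namespace SelfAffine

open scoped ENNReal

/-! ### The difference series -/

/-! Put θ = log(mλ)/log(1/γ), so that γ^(-θ) = mλ; on the region considered 0 < θ < 1.

Upper bound, for every parameter: at level n the attractor lies in m^n rectangles of size comparable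
to γ^n × λ^n. Cutting each into about (λ/γ)^n pieces gives O((mλ/γ)^n) balls of radius comparable to
γ^n, and (mλ/γ)^n = (γ^n)^(-(1+θ)) (`exists_cover_attractor`).

Lower bound, for almost every parameter: the Bernoulli measure projected to the attractor has finite
(a+b)-energy whenever |Π_γ ω - Π_γ ω'|^(-a) |Π_λ ω - Π_λ ω'|^(-b) is integrable over pairs (ω, ω').
Split the pairs by the first index k at which they differ. Self-similarity multiplies the part at k
by γ^(-a) λ^(-b) / m at each step, so the series is geometric and converges if γ^(-a) λ^(-b) < m,
which holds for all a < θ, b < 1. Only the pairs with distinct first symbols remain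
(`lintegral_lt_top_of_head`).

For those pairs the difference of the projections is a series of the class 𝓑. Where γ₀ is not a
double root, the integral of |Π_γ ω - Π_γ ω'|^(-a) in γ near γ₀ is bounded uniformly in the pair,
while correlation dimension 1 of ν_λ makes the factor in λ integrable over pairs; Fubini then gives
finiteness for almost every parameter. Where γ₀ is a double root, λ₀ is not, and the two coordinates
exchange roles. This exchange needs γ ∈ I, and explains the shape of S₁; over J it never occurs
(`ae_headEnergy_lt_top`).

Finite energy gives a Frostman measure, which bounds both dimensions from below. -/

/-- The coefficients of the difference of the series of two digit sequences. -/
def coefDiff {m : ℕ} (d : Fin m → ℝ) (Z : (ℕ → Fin m) × (ℕ → Fin m)) (n : ℕ) : ℝ :=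
  d (Z.1 n) - d (Z.2 n)

/-- The difference `Π_x ω - Π_x ω'`, as the power series with coefficients `coefDiff`. -/
noncomputable def diffSeries {m : ℕ} (d : Fin m → ℝ) (Z : (ℕ → Fin m) × (ℕ → Fin m)) (x : ℝ) : ℝ :=
  seriesSum (coefDiff d Z) x

/-- The termwise derivative of `diffSeries`. -/
noncomputable def diffSeriesDeriv {m : ℕ} (d : Fin m → ℝ) (Z : (ℕ → Fin m) × (ℕ → Fin m))
    (x : ℝ) : ℝ :=
  seriesSum (fun n => (n + 1) * coefDiff d Z (n + 1)) x

/-- The linear factor makes one majorant serve both a series with bounded coefficients and its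
termwise derivative. -/
theorem summable_linear_geometric (C : ℝ) {ρ : ℝ} (h0 : 0 ≤ ρ) (h1 : ρ < 1) :
    Summable fun n : ℕ => C * (n + 1) * ρ ^ n := by
  have hn : ‖ρ‖ < 1 := by rwa [Real.norm_of_nonneg h0]
  have := ((summable_pow_mul_geometric_of_norm_lt_one 1 hn).add
    (summable_geometric_of_lt_one h0 h1)).mul_left C
  refine this.congr fun n => ?_
  ring

theorem abs_term_le {C c x ρ : ℝ} {n : ℕ} (hc : |c| ≤ C * (n + 1)) (hx : |x| ≤ ρ) :
    ‖c * x ^ n‖ ≤ C * (n + 1) * ρ ^ n := by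
  rw [Real.norm_eq_abs, abs_mul, abs_pow]
  exact mul_le_mul hc (pow_le_pow_left₀ (abs_nonneg _) hx n) (by positivity)
    ((abs_nonneg _).trans hc)

/-- Weierstrass' test on a slightly smaller interval. Continuity is joint in the digit data and the
point, since the compactness argument perturbs both at once. -/
theorem continuousOn_seriesSum {Y : Type*} [TopologicalSpace Y] (c : Y → ℕ → ℝ) (C : ℝ)
    (hc : ∀ n, Continuous fun y => c y n) (hC : ∀ y n, |c y n| ≤ C * (n + 1)) :
    ContinuousOn (fun q : Y × ℝ => seriesSum (c q.1) q.2) (Set.univ ×ˢ Set.Ioo (-1) 1) := by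
  rintro ⟨y, x⟩ ⟨-, hx⟩
  obtain ⟨ρ, hxρ, hρ⟩ := exists_between (abs_lt.2 hx)
  have h0 : 0 ≤ ρ := (abs_nonneg _).trans hxρ.le
  have hcont : ContinuousOn (fun q : Y × ℝ => seriesSum (c q.1) q.2)
      (Set.univ ×ˢ Set.Ioo (-ρ) ρ) := by
    refine continuousOn_tsum (u := fun n : ℕ => C * (n + 1) * ρ ^ n) (fun n => ?_)
      (summable_linear_geometric C h0 hρ) fun n q hq => ?_
    · exact (((hc n).comp continuous_fst).mul (continuous_snd.pow n)).continuousOn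
    · exact abs_term_le (hC _ _) (abs_lt.2 hq.2).le
  refine (hcont.continuousAt ?_).continuousWithinAt
  exact (isOpen_univ.prod isOpen_Ioo).mem_nhds ⟨trivial, abs_lt.1 hxρ⟩

theorem hasDerivAt_seriesSum (c : ℕ → ℝ) (C : ℝ) (hC : ∀ n, |c n| ≤ C) {x : ℝ}
    (hx : |x| < 1) :
    HasDerivAt (seriesSum c) (seriesSum (fun n : ℕ => (n + 1) * c (n + 1)) x) x := by
  obtain ⟨ρ, hxρ, hρ⟩ := exists_between hx
  have h0 : 0 ≤ ρ := (abs_nonneg _).trans hxρ.le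
  have hsum (y : ℝ) (hy : |y| < 1) : Summable fun n => c n * y ^ n := by
    refine Summable.of_norm_bounded (summable_linear_geometric C (abs_nonneg y) hy) fun n => ?_
    refine abs_term_le ((hC n).trans ?_) le_rfl
    have : 0 ≤ C := (abs_nonneg _).trans (hC 0)
    nlinarith [n.cast_nonneg (α := ℝ)]
  -- Detaching the constant term lets the derivative of term n + 1 be (n + 1) c (n + 1) x^n, with no
  -- truncated exponent n - 1.
  have hfun : ∀ y ∈ Set.Ioo (-ρ) ρ,
      seriesSum c y = c 0 + ∑' n, c (n + 1) * y ^ (n + 1) := fun y hy => by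
    rw [seriesSum, (hsum y ((abs_lt.2 hy).trans hρ)).tsum_eq_zero_add]
    simp
  have hder : HasDerivAt (fun z => ∑' n : ℕ, c (n + 1) * z ^ (n + 1))
      (∑' n : ℕ, ((n : ℝ) + 1) * c (n + 1) * x ^ n) x := by
    refine hasDerivAt_tsum_of_isPreconnected (t := Set.Ioo (-ρ) ρ) (y₀ := x)
      (g' := fun (n : ℕ) y => ((n : ℝ) + 1) * c (n + 1) * y ^ n)
      (summable_linear_geometric C h0 hρ) isOpen_Ioo isPreconnected_Ioo
      (fun n y _ => ?_) (fun n y hy => ?_) (abs_lt.1 hxρ) ?_ (abs_lt.1 hxρ)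
    · have := (hasDerivAt_pow (n + 1) y).const_mul (c (n + 1))
      convert! this using 1
      push_cast
      ring
    · refine abs_term_le ?_ (abs_lt.2 hy).le
      rw [abs_mul, abs_of_nonneg (by positivity : (0 : ℝ) ≤ n + 1), mul_comm]
      exact mul_le_mul_of_nonneg_right (hC _) (by positivity)
    · exact (summable_nat_add_iff 1).2 (hsum x hx)
  refine ((hder.const_add (c 0)).congr_of_eventuallyEq ?_)
  filter_upwards [isOpen_Ioo.mem_nhds (abs_lt.1 hxρ)] with y hy using hfun y hy

section

variable {m : ℕ} (d : Fin m → ℝ)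

theorem continuous_coefDiff (n : ℕ) : Continuous fun Z => coefDiff d Z n := by
  unfold coefDiff
  exact (continuous_of_discreteTopology.comp ((continuous_apply n).comp continuous_fst)).sub
    (continuous_of_discreteTopology.comp ((continuous_apply n).comp continuous_snd))

theorem exists_abs_coefDiff_le : ∃ C, 0 ≤ C ∧ ∀ Z n, |coefDiff d Z n| ≤ C := by
  obtain ⟨C, hC⟩ := exists_bound d
  refine ⟨|C| + |C|, by positivity, fun Z n => ?_⟩
  exact (abs_sub _ _).trans (add_le_add ((hC _).trans (le_abs_self C))
    ((hC _).trans (le_abs_self C)))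

theorem continuousOn_diffSeries :
    ContinuousOn (fun q : ((ℕ → Fin m) × (ℕ → Fin m)) × ℝ => diffSeries d q.1 q.2)
      (Set.univ ×ˢ Set.Ioo (-1) 1) := by
  obtain ⟨C, h0, hC⟩ := exists_abs_coefDiff_le d
  refine continuousOn_seriesSum _ C (continuous_coefDiff d) fun Z n => (hC Z n).trans ?_
  nlinarith [n.cast_nonneg (α := ℝ)]

theorem continuousOn_diffSeriesDeriv :
    ContinuousOn (fun q : ((ℕ → Fin m) × (ℕ → Fin m)) × ℝ => diffSeriesDeriv d q.1 q.2)
      (Set.univ ×ˢ Set.Ioo (-1) 1) := by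
  obtain ⟨C, h0, hC⟩ := exists_abs_coefDiff_le d
  refine continuousOn_seriesSum (fun Z n => ((n : ℝ) + 1) * coefDiff d Z (n + 1)) C
    (fun n => continuous_const.mul (continuous_coefDiff d _)) fun Z n => ?_
  rw [abs_mul, abs_of_nonneg (by positivity : (0 : ℝ) ≤ n + 1), mul_comm]
  exact mul_le_mul_of_nonneg_right (hC _ _) (by positivity)

theorem hasDerivAt_diffSeries (Z : (ℕ → Fin m) × (ℕ → Fin m)) {x : ℝ} (hx : |x| < 1) :
    HasDerivAt (diffSeries d Z) (diffSeriesDeriv d Z x) x := by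
  obtain ⟨C, -, hC⟩ := exists_abs_coefDiff_le d
  exact hasDerivAt_seriesSum _ C (hC Z) hx

theorem summable_proj {x : ℝ} (hx : |x| < 1) (ω : ℕ → Fin m) :
    Summable fun n => d (ω n) * x ^ n := by
  obtain ⟨C, hC⟩ := exists_bound d
  exact Summable.of_norm_bounded (summable_bound C hx) fun n => term_bound d hC x n ω

theorem diffSeries_eq_sub {x : ℝ} (hx : |x| < 1) (Z : (ℕ → Fin m) × (ℕ → Fin m)) :
    diffSeries d Z x = proj d x Z.1 - proj d x Z.2 := by
  unfold diffSeries proj seriesSum coefDiff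
  rw [← (summable_proj d hx Z.1).tsum_sub (summable_proj d hx Z.2)]
  exact tsum_congr fun n => by ring

/-- The pairs of sequences that differ in their first symbol. -/
def distinctHeads (m : ℕ) : Set ((ℕ → Fin m) × (ℕ → Fin m)) := {Z | Z.1 0 ≠ Z.2 0}

theorem isClopen_distinctHeads : IsClopen (distinctHeads m) := by
  have : Continuous fun Z : (ℕ → Fin m) × (ℕ → Fin m) => (Z.1 0, Z.2 0) := by fun_prop
  exact (isClopen_discrete {q : Fin m × Fin m | q.1 ≠ q.2}).preimage this

/-- Injectivity of `d` turns distinct first symbols into a non-zero constant term; this is how the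
hypotheses on double roots reach pairs of sequences. -/
theorem coefDiff_mem_powerSeriesClass (hd : StrictMono d) {Z : (ℕ → Fin m) × (ℕ → Fin m)}
    (hZ : Z ∈ distinctHeads m) : coefDiff d Z ∈ powerSeriesClass d :=
  ⟨fun _ => Set.sub_mem_sub ⟨_, rfl⟩ ⟨_, rfl⟩, sub_ne_zero.2 (hd.injective.ne hZ)⟩

/-! ### Riesz kernels and transversality -/

/-- The Riesz kernel `|Π_x ω - Π_x ω'| ^ (-a)` on `(-1, 1)`. -/
noncomputable def rieszKernel (a x : ℝ) (Z : (ℕ → Fin m) × (ℕ → Fin m)) : ℝ≥0∞ :=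
  (Set.Ioo (-1 : ℝ) 1).indicator (fun x => ENNReal.ofReal |diffSeries d Z x| ^ (-a)) x

variable {d} in
theorem rieszKernel_of_abs_lt {a x : ℝ} (hx : |x| < 1) (Z : (ℕ → Fin m) × (ℕ → Fin m)) :
    rieszKernel d a x Z = ENNReal.ofReal |diffSeries d Z x| ^ (-a) :=
  Set.indicator_of_mem (show x ∈ Set.Ioo (-1 : ℝ) 1 from abs_lt.1 hx) _

theorem rieszKernel_le (a x : ℝ) (Z : (ℕ → Fin m) × (ℕ → Fin m)) :
    rieszKernel d a x Z ≤ ENNReal.ofReal |diffSeries d Z x| ^ (-a) :=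
  Set.indicator_apply_le fun _ => le_rfl

/-- The series is controlled only on (-1, 1). The cutoff in the kernel yields joint measurability on
the full product, as Tonelli's theorem requires. -/
theorem measurable_rieszKernel (a : ℝ) :
    Measurable fun q : ((ℕ → Fin m) × (ℕ → Fin m)) × ℝ => rieszKernel d a q.2 q.1 := by
  have hS : MeasurableSet
      ((Set.univ : Set ((ℕ → Fin m) × (ℕ → Fin m))) ×ˢ Set.Ioo (-1 : ℝ) 1) :=
    MeasurableSet.univ.prod measurableSet_Ioo
  classical
  have h := (continuousOn_diffSeries d).measurable_piecewise
    (g := fun _ => (0 : ℝ)) continuousOn_const hS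
  have h2 := ((h.abs.ennreal_ofReal).pow_const (-a)).indicator hS
  convert! h2 using 1
  funext q
  by_cases hq : q.2 ∈ Set.Ioo (-1 : ℝ) 1
  · have hq' : q ∈ (Set.univ : Set ((ℕ → Fin m) × (ℕ → Fin m))) ×ˢ Set.Ioo (-1 : ℝ) 1 :=
      ⟨trivial, hq⟩
    rw [Set.indicator_of_mem hq', Set.piecewise_eq_of_mem _ _ _ hq', rieszKernel,
      Set.indicator_of_mem hq]
  · rw [Set.indicator_of_notMem fun h => hq h.2, rieszKernel, Set.indicator_of_notMem hq]

end

/-! ### Integrals of negative powers of functions with steep slope -/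

theorem lintegral_rpow_neg_ne_top {a : ℝ} (ha : a < 1) :
    ∫⁻ u in Set.Icc (-2 : ℝ) 2, ENNReal.ofReal |u| ^ (-a) ≠ ⊤ := by
  have hpos : ∫⁻ u in Set.Ioc (0 : ℝ) 2, ENNReal.ofReal |u| ^ (-a) ≠ ⊤ := by
    have h := (intervalIntegral.intervalIntegrable_rpow' (a := 0) (b := 2)
      (by linarith : -1 < -a)).1
    have h2 := h.2.ne
    refine ne_of_eq_of_ne (setLIntegral_congr_fun measurableSet_Ioc fun u hu => ?_) h2
    rw [abs_of_pos hu.1, ENNReal.ofReal_rpow_of_pos hu.1, Real.enorm_of_nonneg]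
    exact Real.rpow_nonneg hu.1.le _
  have hneg : ∫⁻ u in Set.Ico (-2 : ℝ) 0, ENNReal.ofReal |u| ^ (-a) ≠ ⊤ := by
    have h := (Measure.measurePreserving_neg (volume : Measure ℝ)).setLIntegral_comp_preimage
      (s := Set.Ioc (0 : ℝ) 2) measurableSet_Ioc
      (f := fun u : ℝ => ENNReal.ofReal |u| ^ (-a)) (by fun_prop)
    simp only [abs_neg, Set.neg_preimage, Set.neg_Ioc, neg_zero] at h
    rwa [h]
  have hsub : Set.Icc (-2 : ℝ) 2 ⊆ (Set.Ioc 0 2 ∪ Set.Ico (-2) 0) ∪ {0} := by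
    intro u hu
    rcases lt_trichotomy u 0 with h | h | h
    · exact Or.inl (Or.inr ⟨hu.1, h⟩)
    · exact Or.inr h
    · exact Or.inl (Or.inl ⟨h, hu.2⟩)
  refine ne_top_of_le_ne_top ?_ ((lintegral_mono_set hsub).trans
    ((lintegral_union_le _ _ _).trans (add_le_add_left (lintegral_union_le _ _ _) _)))
  simp [hpos, hneg]

/-- Let z minimise |f| on the interval. The mean value theorem gives δ|x - z| ≤ |f x - f z| ≤ 2|f
x|, so |f|^(-a) is dominated by a multiple of |x - z|^(-a), whether or not f vanishes. The length
bound keeps x - z in [-2, 2], which makes the constant independent of f. -/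
theorem lintegral_rpow_neg_le_of_slope {f f' : ℝ → ℝ} {a p q δ : ℝ} (ha : 0 ≤ a) (hδ : 0 < δ)
    (hpq : p ≤ q) (hlen : q - p ≤ 2) (hf : ∀ x ∈ Set.Icc p q, HasDerivAt f (f' x) x)
    (hf' : ∀ x ∈ Set.Icc p q, δ ≤ |f' x|) :
    ∫⁻ x in Set.Icc p q, ENNReal.ofReal |f x| ^ (-a) ≤
      ENNReal.ofReal (δ / 2) ^ (-a) *
        ∫⁻ u in Set.Icc (-2 : ℝ) 2, ENNReal.ofReal |u| ^ (-a) := by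
  have hcont : ContinuousOn f (Set.Icc p q) := fun x hx =>
    (hf x hx).continuousAt.continuousWithinAt
  obtain ⟨z, hz, hmin⟩ := isCompact_Icc.exists_isMinOn (Set.nonempty_Icc.2 hpq) hcont.abs
  have hlt (x y : ℝ) (hx : x ∈ Set.Icc p q) (hy : y ∈ Set.Icc p q) (hxy : x < y) :
      δ * |y - x| ≤ |f y - f x| := by
    have hsub : Set.Icc x y ⊆ Set.Icc p q := Set.Icc_subset_Icc hx.1 hy.2
    obtain ⟨c, hc, he⟩ := exists_hasDerivAt_eq_slope f f' hxy (hcont.mono hsub)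
      fun t ht => hf t (hsub (Set.Ioo_subset_Icc_self ht))
    have h := hf' c (hsub (Set.Ioo_subset_Icc_self hc))
    rw [he, abs_div, le_div_iff₀ (abs_pos.2 (sub_pos.2 hxy).ne')] at h
    exact h
  have hkey (x : ℝ) (hx : x ∈ Set.Icc p q) : δ / 2 * |x - z| ≤ |f x| := by
    have h1 : δ * |x - z| ≤ |f x - f z| := by
      rcases lt_trichotomy x z with h | h | h
      · rw [abs_sub_comm, abs_sub_comm (f x)]
        exact hlt x z hx hz h
      · simp [h]
      · exact hlt z x hz hx h
    have h2 : |f z| ≤ |f x| := hmin hx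
    have h3 := abs_sub (f x) (f z)
    linarith
  calc ∫⁻ x in Set.Icc p q, ENNReal.ofReal |f x| ^ (-a)
      ≤ ∫⁻ x in Set.Icc p q,
          ENNReal.ofReal (δ / 2) ^ (-a) * ENNReal.ofReal |x - z| ^ (-a) := by
        refine setLIntegral_mono' measurableSet_Icc fun x hx => ?_
        rw [← ENNReal.mul_rpow_of_ne_top ENNReal.ofReal_ne_top ENNReal.ofReal_ne_top,
          ← ENNReal.ofReal_mul (by positivity), ENNReal.rpow_neg, ENNReal.rpow_neg,
          ENNReal.inv_le_inv]
        exact ENNReal.rpow_le_rpow (ENNReal.ofReal_le_ofReal (hkey x hx)) ha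
    _ = ENNReal.ofReal (δ / 2) ^ (-a) *
          ∫⁻ x in Set.Icc p q, ENNReal.ofReal |x - z| ^ (-a) :=
        lintegral_const_mul _ (by fun_prop)
    _ ≤ _ := by
        refine mul_le_mul_right ?_ _
        have h := (measurePreserving_sub_right (volume : Measure ℝ) z).setLIntegral_comp_preimage
          (s := Set.Icc (-2 : ℝ) 2) measurableSet_Icc
          (f := fun u : ℝ => ENNReal.ofReal |u| ^ (-a)) (by fun_prop)
        rw [← h]
        refine lintegral_mono_set fun x hx => ?_
        constructor <;> simp only <;> linarith [hx.1, hx.2, hz.1, hz.2]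

section

variable {m : ℕ} (d : Fin m → ℝ)

theorem exists_pos_le_abs_near {g : ((ℕ → Fin m) × (ℕ → Fin m)) × ℝ → ℝ}
    (hg : ContinuousOn g (Set.univ ×ˢ Set.Ioo (-1) 1)) {x₀ : ℝ} (hx₀ : |x₀| < 1)
    {Z₀ : (ℕ → Fin m) × (ℕ → Fin m)} (h : g (Z₀, x₀) ≠ 0) :
    ∃ U ∈ 𝓝 Z₀, ∃ ε > 0, ∃ δ > 0, ∀ Z ∈ U, ∀ x ∈ Set.Icc (x₀ - ε) (x₀ + ε),
      |x| < 1 ∧ δ ≤ |g (Z, x)| := by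
  have hat : ContinuousAt g (Z₀, x₀) := hg.continuousAt
    ((isOpen_univ.prod isOpen_Ioo).mem_nhds ⟨trivial, abs_lt.1 hx₀⟩)
  have h1 : ∀ᶠ q in 𝓝 (Z₀, x₀), |g (Z₀, x₀)| / 2 < |g q| :=
    hat.abs.eventually (lt_mem_nhds (half_lt_self (abs_pos.2 h)))
  have h2 : ∀ᶠ q : ((ℕ → Fin m) × (ℕ → Fin m)) × ℝ in 𝓝 (Z₀, x₀), |q.2| < 1 :=
    (continuous_abs.comp continuous_snd).continuousAt.eventually (gt_mem_nhds hx₀)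
  have h3 := h1.and h2
  rw [nhds_prod_eq] at h3
  obtain ⟨U, hU, V, hV, hUV⟩ := Filter.mem_prod_iff.1 h3
  obtain ⟨ε, hε, hball⟩ := Metric.nhds_basis_closedBall.mem_iff.1 hV
  rw [Real.closedBall_eq_Icc] at hball
  refine ⟨U, hU, ε, hε, |g (Z₀, x₀)| / 2, half_pos (abs_pos.2 h), fun Z hZ x hx => ?_⟩
  have := hUV (Set.mk_mem_prod hZ (hball hx))
  exact ⟨this.2, this.1.le⟩

/-- Local transversality: if `x₀` is not a double root of the difference series at `Z₀`, then
the Riesz kernel has uniformly bounded integral near `x₀`, for all pairs near `Z₀`. -/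
theorem exists_nhds_lintegral_rieszKernel_le {a : ℝ} (ha : 0 ≤ a) (ha1 : a < 1) {x₀ : ℝ}
    (hx₀ : |x₀| < 1) {Z₀ : (ℕ → Fin m) × (ℕ → Fin m)}
    (h : ¬ IsDoubleRoot (coefDiff d Z₀) x₀) :
    ∃ U ∈ 𝓝 Z₀, ∃ ε > 0, ∃ C : ℝ≥0, ∀ Z ∈ U,
      ∫⁻ x in Set.Icc (x₀ - ε) (x₀ + ε), rieszKernel d a x Z ≤ C := by
  by_cases h0 : diffSeries d Z₀ x₀ = 0
  · have h1 : diffSeriesDeriv d Z₀ x₀ ≠ 0 := fun h1 =>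
      h ⟨hx₀, h0, h1 ▸ hasDerivAt_diffSeries d Z₀ hx₀⟩
    obtain ⟨U, hU, ε, hε, δ, hδ, hb⟩ :=
      exists_pos_le_abs_near (continuousOn_diffSeriesDeriv d) hx₀ h1
    have hfin : ENNReal.ofReal (δ / 2) ^ (-a) *
        ∫⁻ u in Set.Icc (-2 : ℝ) 2, ENNReal.ofReal |u| ^ (-a) ≠ ⊤ :=
      ENNReal.mul_ne_top (ENNReal.rpow_ne_top_of_ne_zero
        (ENNReal.ofReal_pos.2 (by positivity)).ne' ENNReal.ofReal_ne_top)
        (lintegral_rpow_neg_ne_top ha1)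
    refine ⟨U, hU, ε, hε, _, fun Z hZ => (lintegral_mono fun x => rieszKernel_le d a x Z).trans
      ((lintegral_rpow_neg_le_of_slope ha hδ (by linarith) ?_
        (fun x hx => hasDerivAt_diffSeries d Z (hb Z hZ x hx).1)
        fun x hx => (hb Z hZ x hx).2).trans (ENNReal.coe_toNNReal hfin).ge)⟩
    have h1 := abs_lt.1 (hb Z hZ (x₀ - ε) ⟨le_rfl, by linarith⟩).1
    have h2 := abs_lt.1 (hb Z hZ (x₀ + ε) ⟨by linarith, le_rfl⟩).1
    linarith [h1.1, h2.2]
  · obtain ⟨U, hU, ε, hε, δ, hδ, hb⟩ :=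
      exists_pos_le_abs_near (continuousOn_diffSeries d) hx₀ h0
    have hfin : ENNReal.ofReal δ ^ (-a) * volume (Set.Icc (x₀ - ε) (x₀ + ε)) ≠ ⊤ :=
      ENNReal.mul_ne_top (ENNReal.rpow_ne_top_of_ne_zero
        (ENNReal.ofReal_pos.2 hδ).ne' ENNReal.ofReal_ne_top) (by simp)
    refine ⟨U, hU, ε, hε, _, fun Z hZ => le_trans ?_ (ENNReal.coe_toNNReal hfin).ge⟩
    rw [← setLIntegral_const]
    refine setLIntegral_mono' measurableSet_Icc fun x hx => (rieszKernel_le d a x Z).trans ?_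
    rw [ENNReal.rpow_neg, ENNReal.rpow_neg, ENNReal.inv_le_inv]
    exact ENNReal.rpow_le_rpow (ENNReal.ofReal_le_ofReal (hb Z hZ x hx).2) ha

/-- Transversality near `(x₀, y₀)`, uniformly in a compact set of pairs none of which has both
`x₀` and `y₀` as double roots. -/
theorem exists_forall_lintegral_rieszKernel_le {a b : ℝ} (ha : 0 ≤ a) (ha1 : a < 1)
    (hb : 0 ≤ b) (hb1 : b < 1) {x₀ y₀ : ℝ} (hx₀ : |x₀| < 1) (hy₀ : |y₀| < 1)
    {S : Set ((ℕ → Fin m) × (ℕ → Fin m))} (hS : IsCompact S) (A B : Prop)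
    (h : ∀ Z ∈ S, (A ∧ ¬ IsDoubleRoot (coefDiff d Z) x₀) ∨
      (B ∧ ¬ IsDoubleRoot (coefDiff d Z) y₀)) :
    ∃ ε > 0, ∃ C : ℝ≥0, ∀ Z ∈ S,
      (A ∧ ∫⁻ x in Set.Icc (x₀ - ε) (x₀ + ε), rieszKernel d a x Z ≤ C) ∨
      (B ∧ ∫⁻ y in Set.Icc (y₀ - ε) (y₀ + ε), rieszKernel d b y Z ≤ C) := by
  have hmono {x ε ε' c : ℝ} {C C' : ℝ≥0} {Z : (ℕ → Fin m) × (ℕ → Fin m)} (hε : ε' ≤ ε)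
      (hC : C ≤ C') (h : ∫⁻ x in Set.Icc (x - ε) (x + ε), rieszKernel d c x Z ≤ C) :
      ∫⁻ x in Set.Icc (x - ε') (x + ε'), rieszKernel d c x Z ≤ C' :=
    ((lintegral_mono_set (Set.Icc_subset_Icc (by linarith) (by linarith))).trans h).trans
      (by exact_mod_cast hC)
  -- Compact induction: a union of two sets takes the smaller ε and the larger C, and the singleton
  -- stage is local transversality in whichever coordinate has no double root.
  refine hS.induction_on (p := fun S => ∃ ε > 0, ∃ C : ℝ≥0, ∀ Z ∈ S,
      (A ∧ ∫⁻ x in Set.Icc (x₀ - ε) (x₀ + ε), rieszKernel d a x Z ≤ C) ∨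
      (B ∧ ∫⁻ y in Set.Icc (y₀ - ε) (y₀ + ε), rieszKernel d b y Z ≤ C))
    ⟨1, one_pos, 0, by simp⟩ ?_ ?_ ?_
  · rintro s t hst ⟨ε, hε, C, hC⟩
    exact ⟨ε, hε, C, fun Z hZ => hC Z (hst hZ)⟩
  · rintro s t ⟨ε, hε, C, hC⟩ ⟨ε', hε', C', hC'⟩
    refine ⟨min ε ε', lt_min hε hε', max C C', ?_⟩
    rintro Z (hZ | hZ)
    · exact (hC Z hZ).imp
        (fun h => ⟨h.1, hmono (min_le_left _ _) (le_max_left _ _) h.2⟩)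
        (fun h => ⟨h.1, hmono (min_le_left _ _) (le_max_left _ _) h.2⟩)
    · exact (hC' Z hZ).imp
        (fun h => ⟨h.1, hmono (min_le_right _ _) (le_max_right _ _) h.2⟩)
        (fun h => ⟨h.1, hmono (min_le_right _ _) (le_max_right _ _) h.2⟩)
  · intro Z hZ
    rcases h Z hZ with ⟨hA, h⟩ | ⟨hB, h⟩
    · obtain ⟨U, hU, ε, hε, C, hC⟩ := exists_nhds_lintegral_rieszKernel_le d ha ha1 hx₀ h
      exact ⟨U, mem_nhdsWithin_of_mem_nhds hU, ε, hε, C, fun Z hZ => Or.inl ⟨hA, hC Z hZ⟩⟩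
    · obtain ⟨U, hU, ε, hε, C, hC⟩ := exists_nhds_lintegral_rieszKernel_le d hb hb1 hy₀ h
      exact ⟨U, mem_nhdsWithin_of_mem_nhds hU, ε, hε, C, fun Z hZ => Or.inr ⟨hB, hC Z hZ⟩⟩

end

/-! ### Energies of the Bernoulli measure -/

/-- Dyadic decomposition: where |g| is about 2^(-n) the integrand is at most a constant times
2^(nb), on a set of measure at most 2^(-nb'). The gap b < b' makes the sum geometric. -/
theorem lintegral_rpow_neg_ne_top_of_measure_le {Ω : Type*} [MeasurableSpace Ω] {μ : Measure Ω}
    [IsFiniteMeasure μ] {g : Ω → ℝ} (hg : Measurable g) {b b' : ℝ} (hb : 0 < b) (hbb' : b < b')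
    (h : ∀ᶠ r : ℝ in 𝓝[>] 0, μ {ω | |g ω| ≤ r} ≤ ENNReal.ofReal r ^ b') :
    ∫⁻ ω, ENNReal.ofReal |g ω| ^ (-b) ∂μ ≠ ⊤ := by
  have hq : Tendsto (fun n : ℕ => (1 / 2 : ℝ) ^ n) atTop (𝓝[>] 0) :=
    tendsto_pow_atTop_nhdsWithin_zero_of_lt_one (by norm_num) (by norm_num)
  obtain ⟨N, hN⟩ := eventually_atTop.1 (hq.eventually h)
  -- On the zero set of g the integrand is infinite, so this set must be null before any summation.
  have hzero : μ {ω | g ω = 0} = 0 := by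
    have hlim : Tendsto (fun n : ℕ => ENNReal.ofReal ((1 / 2 : ℝ) ^ n) ^ b') atTop (𝓝 0) := by
      have := ((ENNReal.continuous_rpow_const (y := b')).tendsto _).comp
        (ENNReal.tendsto_ofReal (hq.mono_right nhdsWithin_le_nhds))
      simpa [Function.comp_def, ENNReal.zero_rpow_of_pos (hb.trans hbb')] using this
    refine le_antisymm (ge_of_tendsto hlim ?_) zero_le
    filter_upwards [eventually_ge_atTop N] with n hn
    refine (measure_mono fun ω hω => ?_).trans (hN n hn)
    simp only [Set.mem_ofPred_eq] at hω ⊢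
    rw [hω, abs_zero]
    positivity
  -- Below the index N the measure bound is not available; those layers are empty and the constant
  -- term of the majorant covers |g| ≥ 2^(-N).
  set t : ℕ → Set Ω := fun n => {ω | N ≤ n ∧ |g ω| ≤ (1 / 2) ^ n} with ht
  have htm (n : ℕ) : MeasurableSet (t n) := by
    by_cases hn : N ≤ n
    · simp only [ht, hn, true_and]
      exact measurableSet_le hg.abs measurable_const
    · simp [ht, hn]
  set c : ℕ → ℝ≥0∞ := fun n => ENNReal.ofReal ((1 / 2) ^ (n + 1)) ^ (-b) with hc
  have hanti {x y : ℝ} (hxy : x ≤ y) :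
      ENNReal.ofReal y ^ (-b) ≤ ENNReal.ofReal x ^ (-b) := by
    rw [ENNReal.rpow_neg, ENNReal.rpow_neg, ENNReal.inv_le_inv]
    exact ENNReal.rpow_le_rpow (ENNReal.ofReal_le_ofReal hxy) hb.le
  have hpt : ∀ᵐ ω ∂μ, ENNReal.ofReal |g ω| ^ (-b) ≤
      ENNReal.ofReal ((1 / 2) ^ N) ^ (-b) + ∑' n, (t n).indicator (fun _ => c n) ω := by
    have h0 : ∀ᵐ ω ∂μ, g ω ≠ 0 := measure_eq_zero_iff_ae_notMem.1 hzero
    filter_upwards [h0] with ω hω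
    rcases le_total ((1 / 2 : ℝ) ^ N) |g ω| with hle | hle
    · exact (hanti hle).trans le_self_add
    · obtain ⟨n, hn1, hn2⟩ := exists_nat_pow_near_of_lt_one (abs_pos.2 hω)
        (hle.trans (pow_le_one₀ (by norm_num) (by norm_num))) (y := (1 / 2 : ℝ))
        (by norm_num) (by norm_num)
      have hNn : N ≤ n := by
        by_contra hlt
        have : (1 / 2 : ℝ) ^ N ≤ (1 / 2) ^ (n + 1) :=
          pow_le_pow_of_le_one (by norm_num) (by norm_num) (by omega)
        linarith
      have hmem : ω ∈ t n := ⟨hNn, hn2⟩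
      calc ENNReal.ofReal |g ω| ^ (-b) ≤ (t n).indicator (fun _ => c n) ω := by
            rw [Set.indicator_of_mem hmem]
            exact hanti hn1.le
        _ ≤ ∑' n, (t n).indicator (fun _ => c n) ω :=
            ENNReal.le_tsum (f := fun n => (t n).indicator (fun _ => c n) ω) n
        _ ≤ _ := le_add_self
  refine ne_top_of_le_ne_top ?_ (lintegral_mono_ae hpt)
  rw [lintegral_add_left measurable_const, lintegral_const,
    lintegral_tsum fun n => (measurable_const.indicator (htm n)).aemeasurable]
  refine ENNReal.add_ne_top.2 ⟨ENNReal.mul_ne_top (ENNReal.rpow_ne_top_of_ne_zero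
    (ENNReal.ofReal_pos.2 (by positivity)).ne' ENNReal.ofReal_ne_top) (measure_ne_top _ _), ?_⟩
  have hsum : Summable fun n : ℕ => (1 / 2 : ℝ) ^ (-b) * ((1 / 2 : ℝ) ^ (b' - b)) ^ n :=
    (summable_geometric_of_lt_one (by positivity)
      (Real.rpow_lt_one (by norm_num) (by norm_num) (by linarith))).mul_left _
  refine ne_top_of_le_ne_top hsum.tsum_ofReal_ne_top (ENNReal.tsum_le_tsum fun n => ?_)
  rw [lintegral_indicator_const (htm n)]
  by_cases hn : N ≤ n
  · have hpos : (0 : ℝ) < (1 / 2) ^ n := by positivity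
    calc c n * μ (t n) ≤ ENNReal.ofReal ((1 / 2) ^ (n + 1)) ^ (-b) *
          ENNReal.ofReal ((1 / 2) ^ n) ^ b' := by
          refine mul_le_mul_right ((measure_mono fun ω hω => hω.2).trans (hN n hn)) _
      _ = _ := by
          rw [ENNReal.ofReal_rpow_of_pos (by positivity), ENNReal.ofReal_rpow_of_pos hpos,
            ← ENNReal.ofReal_mul (by positivity), pow_succ,
            Real.mul_rpow (by positivity) (by positivity), ← Real.rpow_natCast,
            ← Real.rpow_natCast, ← Real.rpow_mul (by norm_num), ← Real.rpow_mul (by norm_num),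
            ← Real.rpow_mul (by norm_num), mul_right_comm, ← Real.rpow_add (by norm_num),
            mul_comm]
          congr 3
          ring
  · have : t n = ∅ := by simp [ht, hn]
    simp [this]

/-- The product of two copies of the uniform Bernoulli measure. -/
noncomputable def pairMeasure (m : ℕ) [NeZero m] : Measure ((ℕ → Fin m) × (ℕ → Fin m)) :=
  (uniformBernoulli m).prod (uniformBernoulli m)

instance {m : ℕ} [NeZero m] : IsProbabilityMeasure (pairMeasure m) := by
  unfold pairMeasure
  infer_instance

theorem measurable_diffSeries {m : ℕ} (d : Fin m → ℝ) {x : ℝ} (hx : |x| < 1) :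
    Measurable fun Z => diffSeries d Z x := by
  simp only [diffSeries_eq_sub d hx]
  exact ((measurable_proj d hx).comp measurable_fst).sub
    ((measurable_proj d hx).comp measurable_snd)

theorem measure_le_rpow_of_lowerCorrelationDim {m : ℕ} [NeZero m] (d : Fin m → ℝ) {x b : ℝ}
    (hx : |x| < 1) (h : (b : EReal) < lowerCorrelationDim (selfSimilarMeasure d x)) :
    ∀ᶠ r : ℝ in 𝓝[>] 0,
      pairMeasure m {Z | |diffSeries d Z x| ≤ r} ≤ ENNReal.ofReal r ^ b := by
  have hmp := measurable_proj d hx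
  filter_upwards [eventually_lt_of_lt_liminf h, Ioo_mem_nhdsGT (zero_lt_one' ℝ)] with r hr hr1
  have heq : pairMeasure m {Z | |diffSeries d Z x| ≤ r} =
      ((selfSimilarMeasure d x).prod (selfSimilarMeasure d x))
        {p : ℝ × ℝ | |p.1 - p.2| ≤ r} := by
    rw [selfSimilarMeasure, Measure.map_prod_map _ _ hmp hmp, Measure.map_apply
      (hmp.prodMap hmp) (measurableSet_le (by fun_prop) measurable_const), pairMeasure]
    congr 1
    ext Z
    simp [diffSeries_eq_sub d hx]
  rw [heq]
  by_contra! hlt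
  refine absurd hr (not_lt.2 ?_)
  -- For r < 1 division by log r reverses inequalities, so a measure above r^b would force the
  -- quotient of logarithms to be at most b.
  have hneg : Real.log r < 0 := Real.log_neg hr1.1 hr1.2
  have h1 := ENNReal.log_le_log hlt.le
  rw [ENNReal.log_rpow, ENNReal.log_ofReal_of_pos hr1.1] at h1
  refine (EReal.div_le_div_right_of_nonpos (by exact_mod_cast hneg.le) h1).trans ?_
  rw [← EReal.coe_mul, ← EReal.coe_div, mul_div_cancel_right₀ _ hneg.ne]

theorem lintegral_rieszKernel_ne_top {m : ℕ} [NeZero m] (d : Fin m → ℝ) {x b : ℝ}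
    (hx : |x| < 1) (hb : 0 < b) (hb1 : b < 1)
    (h : lowerCorrelationDim (selfSimilarMeasure d x) = 1) :
    ∫⁻ Z, rieszKernel d b x Z ∂pairMeasure m ≠ ⊤ := by
  obtain ⟨b', hbb', hb'⟩ := exists_between hb1
  refine ne_top_of_le_ne_top (lintegral_rpow_neg_ne_top_of_measure_le
    (measurable_diffSeries d hx) hb hbb' (measure_le_rpow_of_lowerCorrelationDim d hx ?_))
    (lintegral_mono fun Z => rieszKernel_le d b x Z)
  rw [h]
  exact_mod_cast hb'

/-! ### First differences, and finiteness of the head energy almost everywhere -/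

section

variable {m : ℕ} (d : Fin m → ℝ)

/-- The pairs of sequences that agree before, but not at, the index `k`. -/
def firstDifference (m k : ℕ) : Set ((ℕ → Fin m) × (ℕ → Fin m)) :=
  {Z | (∀ n < k, Z.1 n = Z.2 n) ∧ Z.1 k ≠ Z.2 k}

theorem measurableSet_eq_at (n : ℕ) :
    MeasurableSet {Z : (ℕ → Fin m) × (ℕ → Fin m) | Z.1 n = Z.2 n} :=
  measurableSet_eq_fun (by fun_prop) (by fun_prop)

theorem measurableSet_firstDifference (k : ℕ) : MeasurableSet (firstDifference m k) := by
  have : firstDifference m k =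
      (⋂ n ∈ Finset.range k, {Z : (ℕ → Fin m) × (ℕ → Fin m) | Z.1 n = Z.2 n}) ∩
        {Z : (ℕ → Fin m) × (ℕ → Fin m) | Z.1 k = Z.2 k}ᶜ := by
    ext Z
    simp [firstDifference]
  rw [this]
  exact (Finset.measurableSet_biInter _ fun n _ => measurableSet_eq_at n).inter
    (measurableSet_eq_at k).compl

theorem prepend_mem_firstDifference_succ (i j : Fin m) (k : ℕ)
    (Z : (ℕ → Fin m) × (ℕ → Fin m)) :
    (prepend i Z.1, prepend j Z.2) ∈ firstDifference m (k + 1) ↔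
      i = j ∧ Z ∈ firstDifference m k := by
  constructor
  · rintro ⟨h1, h2⟩
    exact ⟨h1 0 (by omega), fun n hn => h1 (n + 1) (by omega), h2⟩
  · rintro ⟨rfl, h1, h2⟩
    refine ⟨fun n hn => ?_, h2⟩
    cases n with
    | zero => rfl
    | succ n => exact h1 n (by omega)

theorem measurable_rieszKernel_right (a x : ℝ) : Measurable fun Z => rieszKernel d a x Z := by
  have h := (measurable_rieszKernel d a).comp (measurable_prodMk_right (y := x))
  simpa only [Function.comp_def] using h

/-- A common first symbol cancels in the difference, and the rest is scaled by x. -/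
theorem rieszKernel_prepend {a x : ℝ} (hx0 : 0 < x) (hx1 : x < 1) (i : Fin m)
    (Z : (ℕ → Fin m) × (ℕ → Fin m)) :
    rieszKernel d a x (prepend i Z.1, prepend i Z.2) =
      ENNReal.ofReal (x ^ (-a)) * rieszKernel d a x Z := by
  have hx : |x| < 1 := by rwa [abs_of_pos hx0]
  rw [rieszKernel_of_abs_lt hx, rieszKernel_of_abs_lt hx, diffSeries_eq_sub d hx,
    diffSeries_eq_sub d hx, proj_prepend d hx, proj_prepend d hx, add_sub_add_right_eq_sub,
    ← mul_sub, abs_mul, abs_of_pos hx0, ENNReal.ofReal_mul hx0.le, ← ENNReal.ofReal_rpow_of_pos hx0]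
  rw [ENNReal.mul_rpow_of_ne_top ENNReal.ofReal_ne_top ENNReal.ofReal_ne_top]

variable [NeZero m]

/-- The energy with exponents `a` and `b` restricted to the pairs with distinct heads. -/
noncomputable def headEnergy (a b : ℝ) (p : ℝ × ℝ) : ℝ≥0∞ :=
  ∫⁻ Z in distinctHeads m, rieszKernel d a p.1 Z * rieszKernel d b p.2 Z ∂pairMeasure m

/-- Fix a good y and integrate over x in G first: the f-factor contributes at most C for each Z in
T, leaving C times the finite integral of g. Hence the inner integral is finite for almost every x.
-/
theorem ae_setLIntegral_mul_lt_top {Ω : Type*} [MeasurableSpace Ω] {P : Measure Ω} [SFinite P]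
    {f g : Ω × ℝ → ℝ≥0∞} (hf : Measurable f) (hg : Measurable g) (T : Set Ω) {G L : Set ℝ}
    (hT : MeasurableSet T) (hG : MeasurableSet G) (hL : MeasurableSet L) (C : ℝ≥0)
    (hTC : ∀ Z ∈ T, ∫⁻ x in G, f (Z, x) ≤ C)
    (hfin : ∀ᵐ y, y ∈ L → ∫⁻ Z, g (Z, y) ∂P ≠ ⊤) :
    ∀ᵐ p : ℝ × ℝ, p.1 ∈ G → p.2 ∈ L → ∫⁻ Z in T, f (Z, p.1) * g (Z, p.2) ∂P < ⊤ := by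
  have hE : Measurable fun p : ℝ × ℝ => ∫⁻ Z in T, f (Z, p.1) * g (Z, p.2) ∂P := by
    refine Measurable.lintegral_prod_right'
      (f := fun q : (ℝ × ℝ) × Ω => f (q.2, q.1.1) * g (q.2, q.1.2)) ?_
    exact (hf.comp (by fun_prop)).mul (hg.comp (by fun_prop))
  have hms : MeasurableSet {p : ℝ × ℝ | p.1 ∈ G → p.2 ∈ L →
      ∫⁻ Z in T, f (Z, p.1) * g (Z, p.2) ∂P < ⊤} := by
    have h3 := measurableSet_lt hE (measurable_const (a := (⊤ : ℝ≥0∞)))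
    have : {p : ℝ × ℝ | p.1 ∈ G → p.2 ∈ L → ∫⁻ Z in T, f (Z, p.1) * g (Z, p.2) ∂P < ⊤} =
        (G ×ˢ L)ᶜ ∪ {p : ℝ × ℝ | ∫⁻ Z in T, f (Z, p.1) * g (Z, p.2) ∂P < ⊤} := by
      ext p
      simp only [Set.mem_ofPred_eq, Set.mem_union, Set.mem_compl_iff, Set.mem_prod]
      tauto
    rw [this]
    exact (hG.prod hL).compl.union h3
  rw [Measure.volume_eq_prod, Measure.ae_prod_iff_ae_ae hms, Measure.ae_ae_comm hms]
  filter_upwards [hfin] with y hy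
  by_cases hyL : y ∈ L
  swap
  · exact ae_of_all _ fun x _ h => absurd h hyL
  have hfy : Measurable fun Z => g (Z, y) := hg.comp (by fun_prop)
  have hint : ∫⁻ x in G, ∫⁻ Z in T, f (Z, x) * g (Z, y) ∂P ≠ ⊤ := by
    rw [lintegral_lintegral_swap (by
      exact ((hf.comp measurable_swap).mul (hfy.comp measurable_snd)).aemeasurable)]
    refine ne_top_of_le_ne_top (ENNReal.mul_ne_top (ENNReal.coe_ne_top (r := C)) (hy hyL)) ?_
    rw [← lintegral_const_mul _ hfy]
    refine le_trans (setLIntegral_mono' hT fun Z hZ => ?_) (setLIntegral_le_lintegral T _)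
    have hfZ : Measurable fun x => f (Z, x) := hf.comp measurable_prodMk_left
    rw [lintegral_mul_const _ hfZ]
    exact mul_le_mul_left (hTC Z hZ) _
  have := ae_lt_top (hE.comp (measurable_prodMk_right (y := y))) hint
  rw [ae_restrict_iff' hG] at this
  filter_upwards [this] with x hx hxG _ using hx hxG

theorem exists_nhds_ae_headEnergy_lt_top {a b : ℝ} (ha : 0 < a) (ha1 : a < 1) (hb : 0 < b)
    (hb1 : b < 1) {I : Set ℝ} (hI : MeasurableSet I) (hIsub : I ⊆ Set.Ioo 0 1)
    (hdim : ∀ᵐ l : ℝ, l ∈ I → lowerCorrelationDim (selfSimilarMeasure d l) = 1)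
    {S : Set (ℝ × ℝ)} (hSI : ∀ p ∈ S, p.2 ∈ I) (B : Prop) (hB : B → ∀ p ∈ S, p.1 ∈ I)
    {p₀ : ℝ × ℝ} (h1 : |p₀.1| < 1) (h2 : |p₀.2| < 1)
    (h : ∀ Z ∈ distinctHeads m, ¬ IsDoubleRoot (coefDiff d Z) p₀.1 ∨
      (B ∧ ¬ IsDoubleRoot (coefDiff d Z) p₀.2)) :
    ∃ U ∈ 𝓝 p₀, ∀ᵐ p : ℝ × ℝ, p ∈ U → p ∈ S → headEnergy d a b p < ⊤ := by
  obtain ⟨ε, hε, C, hC⟩ := exists_forall_lintegral_rieszKernel_le d ha.le ha1 hb.le hb1 h1 h2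
    isClopen_distinctHeads.isClosed.isCompact True B fun Z hZ => (h Z hZ).imp_left fun h =>
      ⟨trivial, h⟩
  simp only [true_and] at hC
  set G := Set.Icc (p₀.1 - ε) (p₀.1 + ε)
  set L := Set.Icc (p₀.2 - ε) (p₀.2 + ε)
  have hmD : MeasurableSet (distinctHeads m) := isClopen_distinctHeads.isOpen.measurableSet
  have hmT (c : ℝ) (V : Set ℝ) : MeasurableSet {Z | ∫⁻ x in V, rieszKernel d c x Z ≤ C} :=
    measurableSet_le (measurable_rieszKernel d c).lintegral_prod_right' measurable_const
  have hfin {c : ℝ} (hc : 0 < c) (hc1 : c < 1) {V : Set ℝ} :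
      ∀ᵐ y, y ∈ V ∩ I → ∫⁻ Z, rieszKernel d c y Z ∂pairMeasure m ≠ ⊤ := by
    filter_upwards [hdim] with y hy hyV
    have := hIsub hyV.2
    exact lintegral_rieszKernel_ne_top d (by rw [abs_of_pos this.1]; exact this.2) hc hc1
      (hy hyV.2)
  have hmG : MeasurableSet G := measurableSet_Icc
  have hmL : MeasurableSet L := measurableSet_Icc
  -- `e1` treats the pairs transversal in the first coordinate, with correlation dimension used in
  -- the second. `e2` exchanges the coordinates, so it gives information only where the first
  -- coordinate lies in `I`.
  have e1 := ae_setLIntegral_mul_lt_top (P := pairMeasure m) (measurable_rieszKernel d a)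
    (measurable_rieszKernel d b) _ (hmT a G) hmG (hmL.inter hI) C (fun Z hZ => hZ) (hfin hb hb1)
  have e2 := ae_setLIntegral_mul_lt_top (P := pairMeasure m) (measurable_rieszKernel d b)
    (measurable_rieszKernel d a) _ (hmT b L) hmL (hmG.inter hI) C (fun Z hZ => hZ) (hfin ha ha1)
  have e2' := (Measure.measurePreserving_swap (μ := (volume : Measure ℝ))
    (ν := (volume : Measure ℝ))).quasiMeasurePreserving.ae e2
  refine ⟨G ×ˢ L, prod_mem_nhds (Icc_mem_nhds (by linarith) (by linarith))
    (Icc_mem_nhds (by linarith) (by linarith)), ?_⟩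
  rw [Measure.volume_eq_prod] at e1 ⊢
  filter_upwards [e1, e2'] with p hp1 hp2 hpU hpS
  by_cases hBt : B
  · refine ((lintegral_mono_set fun Z hZ => hC Z hZ).trans (lintegral_union_le _ _ _)).trans_lt
      (ENNReal.add_lt_top.2 ⟨hp1 hpU.1 ⟨hpU.2, hSI p hpS⟩, ?_⟩)
    simp only [hBt, true_and]
    simp only [mul_comm (rieszKernel d a _ _)]
    exact hp2 hpU.2 ⟨hpU.1, hB hBt p hpS⟩
  · simp only [hBt, false_and, or_false] at hC
    exact (lintegral_mono_set fun Z hZ => hC Z hZ).trans_lt (hp1 hpU.1 ⟨hpU.2, hSI p hpS⟩)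

/-- The local statement suffices because a locally null subset of the plane is null. The proposition
`B` records whether transversality in the second coordinate may be used, which requires the first
coordinate to lie in `I`. -/
theorem ae_headEnergy_lt_top {a b : ℝ} (ha : 0 < a) (ha1 : a < 1) (hb : 0 < b)
    (hb1 : b < 1) {I : Set ℝ} (hI : MeasurableSet I) (hIsub : I ⊆ Set.Ioo 0 1)
    (hdim : ∀ᵐ l : ℝ, l ∈ I → lowerCorrelationDim (selfSimilarMeasure d l) = 1)
    {S : Set (ℝ × ℝ)} (hSI : ∀ p ∈ S, p.2 ∈ I) (B : Prop) (hB : B → ∀ p ∈ S, p.1 ∈ I)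
    (hS1 : ∀ p ∈ S, |p.1| < 1) (hS2 : ∀ p ∈ S, |p.2| < 1)
    (h : ∀ p ∈ S, ∀ Z ∈ distinctHeads m, ¬ IsDoubleRoot (coefDiff d Z) p.1 ∨
      (B ∧ ¬ IsDoubleRoot (coefDiff d Z) p.2)) :
    ∀ᵐ p : ℝ × ℝ, p ∈ S → headEnergy d a b p < ⊤ := by
  refine measure_null_of_locally_null _ fun p hp => ?_
  simp only [Set.mem_compl_iff, Set.mem_ofPred_eq, Classical.not_imp] at hp
  obtain ⟨U, hU, hae⟩ := exists_nhds_ae_headEnergy_lt_top d ha ha1 hb hb1 hI hIsub hdim hSI B hB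
    (hS1 p hp.1) (hS2 p hp.1) (h p hp.1)
  refine ⟨_, inter_mem_nhdsWithin _ hU, measure_mono_null (fun q hq => ?_) hae⟩
  simp only [Set.mem_compl_iff, Set.mem_ofPred_eq, Set.mem_inter_iff, Classical.not_imp] at hq ⊢
  tauto

/-! ### From head energies to energies -/

theorem lintegral_uniformBernoulli {h : (ℕ → Fin m) → ℝ≥0∞} (hh : Measurable h) :
    ∫⁻ ω, h ω ∂uniformBernoulli m =
      ∑ i, (m : ℝ≥0∞)⁻¹ * ∫⁻ ω, h (prepend i ω) ∂uniformBernoulli m := by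
  conv_lhs => rw [uniformBernoulli_eq_sum]
  rw [lintegral_finsetSum_measure]
  refine Finset.sum_congr rfl fun i _ => ?_
  rw [lintegral_smul_measure, lintegral_map hh (measurable_prepend i), smul_eq_mul]

/-- Conditioning on the first symbols of both sequences, which are independent and uniform. -/
theorem lintegral_pairMeasure {h : (ℕ → Fin m) × (ℕ → Fin m) → ℝ≥0∞} (hh : Measurable h) :
    ∫⁻ Z, h Z ∂pairMeasure m = ∑ i, ∑ j, (m : ℝ≥0∞)⁻¹ * ((m : ℝ≥0∞)⁻¹ *
      ∫⁻ Z, h (prepend i Z.1, prepend j Z.2) ∂pairMeasure m) := by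
  have hp := measurable_prepend (m := m)
  have hpp (i j : Fin m) : Measurable fun Z : (ℕ → Fin m) × (ℕ → Fin m) =>
      h (prepend i Z.1, prepend j Z.2) :=
    hh.comp (((hp i).comp measurable_fst).prodMk ((hp j).comp measurable_snd))
  have hpi (i : Fin m) : Measurable fun Z : (ℕ → Fin m) × (ℕ → Fin m) =>
      h (prepend i Z.1, Z.2) :=
    hh.comp (((hp i).comp measurable_fst).prodMk measurable_snd)
  unfold pairMeasure
  rw [lintegral_prod _ hh.aemeasurable, lintegral_uniformBernoulli hh.lintegral_prod_right']
  refine Finset.sum_congr rfl fun i _ => ?_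
  rw [← Finset.mul_sum]
  congr 1
  have (ω : ℕ → Fin m) : ∫⁻ ω', h (prepend i ω, ω') ∂uniformBernoulli m =
      ∑ j, (m : ℝ≥0∞)⁻¹ * ∫⁻ ω', h (prepend i ω, prepend j ω') ∂uniformBernoulli m :=
    lintegral_uniformBernoulli (hh.comp measurable_prodMk_left)
  simp only [this]
  rw [lintegral_finsetSum' _ fun j _ =>
    ((hpp i j).lintegral_prod_right'.const_mul _).aemeasurable]
  refine Finset.sum_congr rfl fun j _ => ?_
  rw [lintegral_const_mul _ (hpp i j).lintegral_prod_right',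
    lintegral_prod _ (hpp i j).aemeasurable]

/-- Only m of the m² pairs of first symbols agree, so each further common symbol costs a factor 1/m.
-/
theorem sum_diag_const (c : ℝ≥0∞) :
    ∑ i : Fin m, ∑ j : Fin m, (m : ℝ≥0∞)⁻¹ * ((m : ℝ≥0∞)⁻¹ * if i = j then c else 0) =
      (m : ℝ≥0∞)⁻¹ * c := by
  have hm : (m : ℝ≥0∞) ≠ 0 := by exact_mod_cast NeZero.ne m
  simp only [mul_ite, mul_zero, Finset.sum_ite_eq, Finset.mem_univ, if_true, Finset.sum_const,
    Finset.card_univ, Fintype.card_fin, nsmul_eq_mul]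
  rw [← mul_assoc, ENNReal.mul_inv_cancel hm (ENNReal.natCast_ne_top m), one_mul]

theorem setLIntegral_firstDifference_succ {h : (ℕ → Fin m) × (ℕ → Fin m) → ℝ≥0∞}
    (hh : Measurable h) (ρ : ℝ≥0∞)
    (hρ : ∀ i Z, h (prepend i Z.1, prepend i Z.2) = ρ * h Z) (k : ℕ) :
    ∫⁻ Z in firstDifference m (k + 1), h Z ∂pairMeasure m =
      (m : ℝ≥0∞)⁻¹ * (ρ * ∫⁻ Z in firstDifference m k, h Z ∂pairMeasure m) := by
  have hk := measurableSet_firstDifference (m := m) k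
  have hk1 := measurableSet_firstDifference (m := m) (k + 1)
  rw [← lintegral_indicator hk1, ← lintegral_indicator hk,
    lintegral_pairMeasure (hh.indicator hk1), ← sum_diag_const]
  refine Finset.sum_congr rfl fun i _ => Finset.sum_congr rfl fun j _ => ?_
  congr 2
  rw [← lintegral_const_mul _ (hh.indicator hk)]
  split_ifs with hij
  · subst hij
    refine lintegral_congr fun Z => ?_
    by_cases hZ : Z ∈ firstDifference m k
    · rw [Set.indicator_of_mem hZ, Set.indicator_of_mem
        ((prepend_mem_firstDifference_succ i i k Z).2 ⟨rfl, hZ⟩), hρ]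
    · rw [Set.indicator_of_notMem hZ, Set.indicator_of_notMem fun h =>
        hZ ((prepend_mem_firstDifference_succ i i k Z).1 h).2, mul_zero]
  · rw [lintegral_eq_zero_iff' ?_]
    · refine ae_of_all _ fun Z => Set.indicator_of_notMem (fun h =>
        hij ((prepend_mem_firstDifference_succ i j k Z).1 h).1) _
    · exact ((hh.indicator hk1).comp (((measurable_prepend i).comp measurable_fst).prodMk
        ((measurable_prepend j).comp measurable_snd))).aemeasurable

/-- Conditioning on the first symbols gives p = p/m for the measure p of the diagonal, hence p = 0
as p is finite and m > 1. -/
theorem pairMeasure_diagonal (hm : 1 < m) :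
    pairMeasure m {Z | ∀ n, Z.1 n = Z.2 n} = 0 := by
  set Δ : Set ((ℕ → Fin m) × (ℕ → Fin m)) := {Z | ∀ n, Z.1 n = Z.2 n} with hΔ
  have hmeas : MeasurableSet Δ := by
    rw [hΔ, Set.ofPred_forall]
    exact MeasurableSet.iInter measurableSet_eq_at
  have hmem (i j : Fin m) (Z : (ℕ → Fin m) × (ℕ → Fin m)) :
      (prepend i Z.1, prepend j Z.2) ∈ Δ ↔ i = j ∧ Z ∈ Δ := by
    constructor
    · intro h
      exact ⟨h 0, fun n => h (n + 1)⟩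
    · rintro ⟨rfl, h⟩ n
      cases n with
      | zero => rfl
      | succ n => exact h n
  have hrec : pairMeasure m Δ = (m : ℝ≥0∞)⁻¹ * pairMeasure m Δ := by
    conv_lhs => rw [← lintegral_indicator_one hmeas,
      lintegral_pairMeasure (measurable_one.indicator hmeas)]
    rw [← sum_diag_const]
    refine Finset.sum_congr rfl fun i _ => Finset.sum_congr rfl fun j _ => ?_
    congr 2
    split_ifs with hij
    · subst hij
      rw [← lintegral_indicator_one hmeas]
      refine lintegral_congr fun Z => ?_
      by_cases hZ : Z ∈ Δ
      · rw [Set.indicator_of_mem hZ, Set.indicator_of_mem ((hmem i i Z).2 ⟨rfl, hZ⟩)]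
        rfl
      · rw [Set.indicator_of_notMem hZ, Set.indicator_of_notMem fun h => hZ ((hmem i i Z).1 h).2]
    · refine (lintegral_congr fun Z => ?_).trans lintegral_zero
      exact Set.indicator_of_notMem (fun h => hij ((hmem i j Z).1 h).1) _
  by_contra h0
  have hfin := measure_ne_top (pairMeasure m) Δ
  have h1 : (m : ℝ≥0∞)⁻¹ < 1 := ENNReal.inv_lt_one.2 (by exact_mod_cast hm)
  have := ENNReal.mul_lt_mul_left h0 hfin h1
  rw [one_mul, ← hrec] at this
  exact lt_irrefl _ this

/-- Off the null diagonal a pair has a first index of difference k, and the integral over those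
pairs is (ρ/m)^k times the one over distinct heads. The sum converges because ρ < m. -/
theorem lintegral_lt_top_of_head {h : (ℕ → Fin m) × (ℕ → Fin m) → ℝ≥0∞} (hh : Measurable h)
    (hm : 1 < m) {ρ : ℝ≥0∞} (hρ : ∀ i Z, h (prepend i Z.1, prepend i Z.2) = ρ * h Z)
    (hρm : ρ < m) (hfin : ∫⁻ Z in distinctHeads m, h Z ∂pairMeasure m < ⊤) :
    ∫⁻ Z, h Z ∂pairMeasure m < ⊤ := by
  have hk (k : ℕ) : ∫⁻ Z in firstDifference m k, h Z ∂pairMeasure m =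
      ((m : ℝ≥0∞)⁻¹ * ρ) ^ k * ∫⁻ Z in distinctHeads m, h Z ∂pairMeasure m := by
    induction k with
    | zero =>
      have : firstDifference m 0 = distinctHeads m := by
        ext Z
        simp [firstDifference, distinctHeads]
      rw [this, pow_zero, one_mul]
    | succ k ih =>
      rw [setLIntegral_firstDifference_succ hh ρ hρ, ih, pow_succ']
      ring
  have hcov : (Set.univ : Set ((ℕ → Fin m) × (ℕ → Fin m))) ⊆
      {Z | ∀ n, Z.1 n = Z.2 n} ∪ ⋃ k, firstDifference m k := by
    intro Z _
    by_cases hZ : ∃ n, Z.1 n ≠ Z.2 n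
    · classical
      refine Or.inr (Set.mem_iUnion.2 ⟨Nat.find hZ, fun n hn => ?_, Nat.find_spec hZ⟩)
      simpa using Nat.find_min hZ hn
    · push Not at hZ
      exact Or.inl hZ
  have hratio : (m : ℝ≥0∞)⁻¹ * ρ < 1 := by
    rw [mul_comm, ← div_eq_mul_inv]
    exact ENNReal.div_lt_of_lt_mul (by rwa [one_mul])
  rw [← setLIntegral_univ]
  refine ((lintegral_mono_set hcov).trans (lintegral_union_le _ _ _)).trans_lt ?_
  rw [setLIntegral_measure_zero _ _ (pairMeasure_diagonal hm), zero_add]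
  refine (lintegral_iUnion_le _ _).trans_lt ?_
  simp only [hk]
  rw [ENNReal.tsum_mul_right, ENNReal.tsum_geometric]
  exact ENNReal.mul_lt_top (ENNReal.inv_lt_top.2 (tsub_pos_of_lt hratio)) hfin

theorem lintegral_rieszKernel_mul_lt_top {a b γ l : ℝ} (hγ0 : 0 < γ) (hγ1 : γ < 1) (hl0 : 0 < l)
    (hl1 : l < 1) (hm : 1 < m) (hfin : headEnergy d a b (γ, l) < ⊤)
    (hab : γ ^ (-a) * l ^ (-b) < m) :
    ∫⁻ Z, rieszKernel d a γ Z * rieszKernel d b l Z ∂pairMeasure m < ⊤ := by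
  refine lintegral_lt_top_of_head (h := fun Z => rieszKernel d a γ Z * rieszKernel d b l Z)
    ((measurable_rieszKernel_right d a γ).mul (measurable_rieszKernel_right d b l)) hm
    (ρ := ENNReal.ofReal (γ ^ (-a) * l ^ (-b)))
    (fun i Z => ?_) ?_ hfin
  · rw [rieszKernel_prepend d (a := a) hγ0 hγ1 i Z, rieszKernel_prepend d (a := b) hl0 hl1 i Z,
      ENNReal.ofReal_mul (Real.rpow_nonneg hγ0.le _), mul_mul_mul_comm]
  · rw [← ENNReal.ofReal_natCast]
    exact (ENNReal.ofReal_lt_ofReal_iff (by positivity)).2 hab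

end

/-! ### Lower bounds for dimensions from finite energy -/

/-- Finite energy makes the potential finite almost everywhere, hence bounded on some set A of
positive measure. If S meets A at x, all of S lies within its diameter of x, and Markov's inequality
for the potential at x bounds the measure of S. -/
theorem exists_measure_le_ediam_rpow {X : Type*} [MetricSpace X] [MeasurableSpace X] [BorelSpace X]
    [SecondCountableTopology X] (μ : Measure X) [IsProbabilityMeasure μ] {t : ℝ} (ht : 0 < t)
    (h : ∫⁻ x, ∫⁻ y, edist x y ^ (-t) ∂μ ∂μ < ⊤) :
    ∃ A : Set X, MeasurableSet A ∧ μ A ≠ 0 ∧ ∃ M : ℝ≥0, M ≠ 0 ∧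
      ∀ S : Set X, μ.restrict A S ≤ M * Metric.ediam S ^ t := by
  have hker : Measurable fun q : X × X => edist q.1 q.2 ^ (-t) := measurable_edist.pow_const _
  have hU : Measurable fun x => ∫⁻ y, edist x y ^ (-t) ∂μ := hker.lintegral_prod_right'
  set A : ℕ → Set X := fun n => {x | ∫⁻ y, edist x y ^ (-t) ∂μ ≤ (n + 1 : ℕ)}
  have hA (n : ℕ) : MeasurableSet (A n) := measurableSet_le hU measurable_const
  have hpos : μ (⋃ n, A n) ≠ 0 := by
    have hae : ∀ᵐ x ∂μ, x ∈ ⋃ n, A n := by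
      filter_upwards [ae_lt_top hU h.ne] with x hx
      obtain ⟨n, hn⟩ := ENNReal.exists_nat_gt hx.ne
      exact Set.mem_iUnion.2 ⟨n, hn.le.trans (by exact_mod_cast n.le_succ)⟩
    rw [(prob_compl_eq_zero_iff (MeasurableSet.iUnion hA)).1 hae]
    exact one_ne_zero
  obtain ⟨n, hn⟩ := exists_measure_pos_of_not_measure_iUnion_null hpos
  refine ⟨A n, hA n, hn.ne', (n + 1 : ℕ), by positivity, fun S => ?_⟩
  rw [Measure.restrict_apply' (hA n)]
  rcases (S ∩ A n).eq_empty_or_nonempty with he | ⟨x, hxS, hxA⟩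
  · rw [he, measure_empty]
    exact zero_le
  refine (measure_mono Set.inter_subset_left).trans ?_
  have h1 : Metric.ediam S ^ (-t) * μ S ≤ (n + 1 : ℕ) := by
    refine le_trans ?_ hxA
    refine le_trans (mul_le_mul_right (measure_mono fun y hy => ?_) _)
      (mul_meas_ge_le_lintegral (hker.comp measurable_prodMk_left) (Metric.ediam S ^ (-t)))
    simp only [Function.comp_apply, Set.mem_ofPred_eq]
    rw [ENNReal.rpow_neg, ENNReal.rpow_neg, ENNReal.inv_le_inv]
    exact ENNReal.rpow_le_rpow (Metric.edist_le_ediam_of_mem hxS hy) ht.le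
  rw [ENNReal.rpow_neg] at h1
  rcases eq_or_ne (Metric.ediam S ^ t) 0 with h0 | h0
  · rw [h0, ENNReal.inv_zero] at h1
    have : μ S = 0 := by
      by_contra hne
      rw [ENNReal.top_mul hne, top_le_iff] at h1
      exact ENNReal.natCast_ne_top _ h1
    rw [this]
    exact zero_le
  rcases eq_or_ne (Metric.ediam S ^ t) ⊤ with h2 | h2
  · rw [h2, ENNReal.mul_top (by positivity)]
    exact le_top
  · rw [mul_comm, ← div_eq_mul_inv, ENNReal.div_le_iff h0 h2] at h1
    exact h1

theorem le_dimH_of_measure_le_ediam_rpow {X : Type*} [MetricSpace X] [MeasurableSpace X]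
    [BorelSpace X] {ν : Measure X} {t : ℝ} (ht : 0 ≤ t) {M : ℝ≥0} (hM : M ≠ 0)
    (h : ∀ S : Set X, ν S ≤ M * Metric.ediam S ^ t) {K : Set X} (hK : ν K ≠ 0) :
    ENNReal.ofReal t ≤ dimH K := by
  have hM' : (M : ℝ≥0∞) ≠ 0 := by exact_mod_cast hM
  have hle : (M : ℝ≥0∞)⁻¹ • ν ≤ μH[t] := by
    refine Measure.le_hausdorffMeasure t _ 1 one_pos fun S _ => ?_
    rw [Measure.smul_apply, smul_eq_mul, mul_comm, ← div_eq_mul_inv]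
    exact ENNReal.div_le_of_le_mul' (h S)
  have hpos : μH[t] K ≠ 0 := fun h0 => by
    have := hle K
    rw [h0, Measure.smul_apply, smul_eq_mul, nonpos_iff_eq_zero, mul_eq_zero] at this
    exact this.elim (ENNReal.inv_ne_zero.2 ENNReal.coe_ne_top) hK
  have h2 := le_dimH_of_hausdorffMeasure_ne_zero (d := t.toNNReal) (s := K)
    (by rwa [Real.coe_toNNReal t ht])
  exact h2

theorem ediam_closedBall_le {X : Type*} [PseudoMetricSpace X] (p : X) {r : ℝ} :
    Metric.ediam (Metric.closedBall p r) ≤ ENNReal.ofReal (2 * r) := by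
  refine Metric.ediam_le fun x hx y hy => ?_
  rw [edist_dist]
  refine ENNReal.ofReal_le_ofReal ?_
  have := dist_triangle_right x y p
  rw [Metric.mem_closedBall] at hx hy
  linarith

/-- N balls of radius r carry mass at most N M (2r)^t, which must reach that of K. Finiteness of the
covering number is assumed because `toNat` sends ⊤ to 0. -/
theorem exists_le_externalCoveringNumber {X : Type*} [MetricSpace X] [MeasurableSpace X]
    {ν : Measure X} {t : ℝ} (ht : 0 < t) {M : ℝ≥0} (hM : M ≠ 0)
    (h : ∀ S : Set X, ν S ≤ M * Metric.ediam S ^ t) {K : Set X} (hK : ν K ≠ 0)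
    (hKfin : ν K ≠ ⊤) :
    ∃ c > 0, ∀ r : ℝ≥0, 0 < r → Metric.externalCoveringNumber r K ≠ ⊤ →
      c * (r : ℝ) ^ (-t) ≤ (Metric.externalCoveringNumber r K).toNat := by
  have hMpos : (0 : ℝ) < M := by exact_mod_cast pos_iff_ne_zero.2 hM
  have hKpos : 0 < (ν K).toReal := ENNReal.toReal_pos hK hKfin
  refine ⟨(ν K).toReal / (M * 2 ^ t), by positivity, fun r hr hfin => ?_⟩
  set a : ℝ := (ν K).toReal / (M * 2 ^ t) * (r : ℝ) ^ (-t) with ha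
  have hrpos : (0 : ℝ) < r := hr
  have key : (⌈a⌉₊ : ℕ∞) ≤ Metric.externalCoveringNumber r K := by
    refine le_iInf₂ fun C hC => ?_
    rcases C.finite_or_infinite with hCf | hCi
    swap
    · rw [hCi.encard_eq]
      exact le_top
    rw [hCf.encard_eq_coe_toFinset_card]
    refine Nat.cast_le.2 (Nat.ceil_le.2 ?_)
    have h1 : ν K ≤ hCf.toFinset.card * (M * ENNReal.ofReal (2 * r) ^ t) := by
      have hsub : K ⊆ ⋃ p ∈ hCf.toFinset, Metric.closedBall p r := by
        simpa using hC.subset_iUnion_closedBall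
      refine (measure_mono hsub).trans ((measure_biUnion_finset_le _ _).trans ?_)
      rw [← nsmul_eq_mul]
      refine Finset.sum_le_card_nsmul _ _ _ fun p _ => (h _).trans ?_
      exact mul_le_mul_right (ENNReal.rpow_le_rpow (ediam_closedBall_le p) ht.le) _
    have h2 := ENNReal.toReal_mono (by finiteness) h1
    rw [ENNReal.toReal_mul, ENNReal.toReal_mul, ← ENNReal.toReal_rpow,
      ENNReal.toReal_ofReal (by positivity), ENNReal.toReal_natCast, ENNReal.coe_toReal,
      Real.mul_rpow (by norm_num) hrpos.le] at h2
    rw [ha, Real.rpow_neg hrpos.le, ← div_eq_mul_inv, div_div, div_le_iff₀ (by positivity),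
      mul_assoc (M : ℝ)]
    exact h2
  obtain ⟨N, hN⟩ := ENat.ne_top_iff_exists.1 hfin
  rw [← hN] at key ⊢
  rw [ENat.toNat_natCast]
  exact (Nat.le_ceil a).trans (by exact_mod_cast key)

/-! ### Upper bounds for dimensions from covers -/

theorem dimH_le_of_covers {X : Type*} [MetricSpace X] {K : Set X} {s γ C R : ℝ}
    (hs : 0 ≤ s) (hγ0 : 0 < γ) (hγ1 : γ < 1) (hR : 0 < R)
    (h : ∀ n : ℕ, ∃ F : Finset X, K ⊆ ⋃ p ∈ F, Metric.closedBall p (R * γ ^ n) ∧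
      (F.card : ℝ) ≤ C * (γ ^ n) ^ (-s)) : dimH K ≤ ENNReal.ofReal s := by
  borelize X
  choose F hF hcard using h
  have hle : μH[s] K ≤ ENNReal.ofReal (C * (2 * R) ^ s) := by
    refine (Measure.hausdorffMeasure_le_liminf_sum (ι := fun n => F n) s K (l := atTop)
      (fun n => ENNReal.ofReal (2 * (R * γ ^ n))) ?_
      (fun n p => Metric.closedBall p (R * γ ^ n))
      (Eventually.of_forall fun n p => ediam_closedBall_le _)
      (Eventually.of_forall fun n => ?_)).trans
      (liminf_le_of_frequently_le' (Eventually.of_forall fun n => ?_).frequently)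
    · have h0 : Tendsto (fun n : ℕ => 2 * (R * γ ^ n)) atTop (𝓝 0) := by
        simpa using ((tendsto_pow_atTop_nhds_zero_of_lt_one hγ0.le hγ1).const_mul R).const_mul 2
      simpa using ENNReal.tendsto_ofReal h0
    · refine (hF n).trans fun x hx => ?_
      obtain ⟨p, hp, hxp⟩ := Set.mem_iUnion₂.1 hx
      exact Set.mem_iUnion.2 ⟨⟨p, hp⟩, hxp⟩
    · have hpos : 0 < γ ^ n := by positivity
      calc ∑ p : F n, Metric.ediam (Metric.closedBall (p : X) (R * γ ^ n)) ^ s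
          ≤ ∑ p : F n, ENNReal.ofReal (2 * (R * γ ^ n)) ^ s :=
            Finset.sum_le_sum fun p _ => ENNReal.rpow_le_rpow (ediam_closedBall_le _) hs
        _ = ENNReal.ofReal ((F n).card * (2 * (R * γ ^ n)) ^ s) := by
            rw [Finset.sum_const, Finset.card_univ, Fintype.card_coe, nsmul_eq_mul,
              ENNReal.ofReal_rpow_of_pos (by positivity), ENNReal.ofReal_mul (by positivity),
              ENNReal.ofReal_natCast]
        _ ≤ ENNReal.ofReal (C * (2 * R) ^ s) := by
            refine ENNReal.ofReal_le_ofReal ?_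
            rw [← mul_assoc 2, Real.mul_rpow (by positivity) hpos.le]
            calc ((F n).card : ℝ) * ((2 * R) ^ s * (γ ^ n) ^ s)
                ≤ C * (γ ^ n) ^ (-s) * ((2 * R) ^ s * (γ ^ n) ^ s) :=
                  mul_le_mul_of_nonneg_right (hcard n) (by positivity)
              _ = C * (2 * R) ^ s * ((γ ^ n) ^ (-s) * (γ ^ n) ^ s) := by ring
              _ = _ := by rw [← Real.rpow_add hpos, neg_add_cancel, Real.rpow_zero, mul_one]
  have h2 := dimH_le_of_hausdorffMeasure_ne_top (d := s.toNNReal) (s := K)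
    (by rw [Real.coe_toNNReal s hs]; exact ne_top_of_le_ne_top ENNReal.ofReal_ne_top hle)
  exact h2

/-- A radius r with Rγ^(n+1) < r ≤ Rγ^n is served by the cover at level n + 1; the extra level costs
only the factor γ^(-s). -/
theorem exists_externalCoveringNumber_le {X : Type*} [MetricSpace X] {K : Set X} {s γ C R : ℝ}
    (hs : 0 ≤ s) (hγ0 : 0 < γ) (hγ1 : γ < 1) (hR : 0 < R) (hC : 0 < C)
    (h : ∀ n : ℕ, ∃ F : Finset X, K ⊆ ⋃ p ∈ F, Metric.closedBall p (R * γ ^ n) ∧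
      (F.card : ℝ) ≤ C * (γ ^ n) ^ (-s)) :
    ∃ C' > 0, ∀ r : ℝ≥0, 0 < r → (r : ℝ) ≤ R → Metric.externalCoveringNumber r K ≠ ⊤ ∧
      ((Metric.externalCoveringNumber r K).toNat : ℝ) ≤ C' * (r : ℝ) ^ (-s) := by
  refine ⟨C * γ ^ (-s) * R ^ s, by positivity, fun r hr hrR => ?_⟩
  have hrpos : (0 : ℝ) < r := hr
  obtain ⟨n, hn1, hn2⟩ := exists_nat_pow_near_of_lt_one (div_pos hrpos hR)
    ((div_le_one hR).2 hrR) hγ0 hγ1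
  obtain ⟨F, hF, hcard⟩ := h (n + 1)
  have hball : R * γ ^ (n + 1) ≤ r := by
    rw [lt_div_iff₀ hR] at hn1
    linarith
  have hcov : Metric.IsCover r K (F : Set X) := by
    refine Metric.IsCover.of_subset_iUnion_closedBall (hF.trans ?_)
    simp only [Finset.mem_coe]
    exact Set.iUnion₂_mono fun p _ => Metric.closedBall_subset_closedBall hball
  have hle : Metric.externalCoveringNumber r K ≤ F.card :=
    hcov.externalCoveringNumber_le_encard.trans (Set.encard_coe_eq_coe_finsetCard F).le
  refine ⟨ne_top_of_le_ne_top (ENat.natCast_ne_top _) hle, ?_⟩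
  have h1 : (Metric.externalCoveringNumber r K).toNat ≤ F.card := ENat.toNat_le_of_le_natCast hle
  have hpow : (γ ^ n) ^ (-s) ≤ ((r : ℝ) / R) ^ (-s) :=
    Real.rpow_le_rpow_of_nonpos (by positivity) hn2 (by linarith)
  calc ((Metric.externalCoveringNumber r K).toNat : ℝ) ≤ F.card := by exact_mod_cast h1
    _ ≤ C * (γ ^ (n + 1)) ^ (-s) := hcard
    _ = C * γ ^ (-s) * (γ ^ n) ^ (-s) := by
        rw [pow_succ', Real.mul_rpow hγ0.le (by positivity), mul_assoc]
    _ ≤ C * γ ^ (-s) * ((r : ℝ) / R) ^ (-s) := mul_le_mul_of_nonneg_left hpow (by positivity)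
    _ = _ := by
        rw [Real.div_rpow hrpos.le hR.le, Real.rpow_neg hR.le, div_inv_eq_mul]
        ring

theorem hasBoxDim_of_bounds {X : Type*} [MetricSpace X] {K : Set X} (hK : TotallyBounded K)
    {s C R : ℝ} (hC : 0 < C) (hR : 0 < R)
    (hup : ∀ r : ℝ≥0, 0 < r → (r : ℝ) ≤ R → Metric.externalCoveringNumber r K ≠ ⊤ ∧
      ((Metric.externalCoveringNumber r K).toNat : ℝ) ≤ C * (r : ℝ) ^ (-s))
    (hlow : ∀ t < s, ∃ u > t, ∃ c > 0, ∀ r : ℝ≥0, 0 < r →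
      Metric.externalCoveringNumber r K ≠ ⊤ →
      c * (r : ℝ) ^ (-u) ≤ (Metric.externalCoveringNumber r K).toNat) : HasBoxDim K s := by
  refine ⟨hK, ?_⟩
  have hcoe : Tendsto (fun r : ℝ≥0 => (r : ℝ)) (𝓝[>] 0) (𝓝[>] 0) := by
    refine tendsto_nhdsWithin_iff.2 ⟨?_, ?_⟩
    · exact (NNReal.continuous_coe.tendsto 0).mono_left nhdsWithin_le_nhds
    · filter_upwards [self_mem_nhdsWithin] with r hr using hr
  have hL : Tendsto (fun r : ℝ≥0 => Real.log (1 / (r : ℝ))) (𝓝[>] 0) atTop := by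
    simp only [one_div, Real.log_inv]
    exact tendsto_neg_atBot_atTop.comp (Real.tendsto_log_nhdsGT_zero.comp hcoe)
  have hsmall : ∀ᶠ r : ℝ≥0 in 𝓝[>] 0, 0 < r ∧ (r : ℝ) ≤ R := by
    filter_upwards [self_mem_nhdsWithin, hcoe.eventually (Ioc_mem_nhdsGT hR)] with r h1 h2
    exact ⟨h1, h2.2⟩
  have hlogr (r : ℝ≥0) (u : ℝ) (hr : 0 < r) (c : ℝ) (hc : 0 < c) :
      Real.log (c * (r : ℝ) ^ (-u)) = Real.log c + u * Real.log (1 / (r : ℝ)) := by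
    have hrpos : (0 : ℝ) < r := hr
    rw [Real.log_mul hc.ne' (Real.rpow_pos_of_pos hrpos _).ne', Real.log_rpow hrpos, one_div,
      Real.log_inv]
    ring
  have hlow' {t : ℝ} (hts : t < s) : ∃ u > t, ∃ c > 0, ∀ᶠ r : ℝ≥0 in 𝓝[>] 0,
      0 < ((Metric.externalCoveringNumber r K).toNat : ℝ) ∧
      Real.log c + u * Real.log (1 / (r : ℝ)) ≤
        Real.log ((Metric.externalCoveringNumber r K).toNat : ℝ) := by
    obtain ⟨u, hu, c, hc, h⟩ := hlow t hts
    refine ⟨u, hu, c, hc, ?_⟩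
    filter_upwards [hsmall] with r hr
    have hrpos : (0 : ℝ) < r := hr.1
    have h1 := h r hr.1 (hup r hr.1 hr.2).1
    have h2 : 0 < c * (r : ℝ) ^ (-u) := by positivity
    rw [← hlogr r u hr.1 c hc]
    exact ⟨h2.trans_le h1, Real.log_le_log h2 h1⟩
  refine tendsto_order.2 ⟨fun t hts => ?_, fun t hst => ?_⟩
  · obtain ⟨u, hu, c, -, h⟩ := hlow' hts
    filter_upwards [h, hL.eventually_gt_atTop 0,
      (hL.const_mul_atTop (sub_pos.2 hu)).eventually_gt_atTop (-Real.log c)] with r h1 h2 h3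
    rw [lt_div_iff₀ h2]
    nlinarith [h1.2]
  -- The lower bound at s - 1 serves only to make the covering number positive, so that its
  -- logarithm is monotone.
  · obtain ⟨u, -, c, -, h⟩ := hlow' (sub_one_lt s)
    filter_upwards [h, hsmall, hL.eventually_gt_atTop 0,
      (hL.const_mul_atTop (sub_pos.2 hst)).eventually_gt_atTop (Real.log C)] with r h1 h2 h3 h4
    rw [div_lt_iff₀ h3]
    have h5 := Real.log_le_log h1.1 (hup r h2.1 h2.2).2
    rw [hlogr r s h2.1 C hC] at h5
    nlinarith

/-! ### The cover of the attractor by small balls -/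

section

variable {m : ℕ} (d : Fin m → ℝ)

theorem exists_abs_proj_le {x : ℝ} (hx : |x| < 1) : ∃ B, ∀ ω, |proj d x ω| ≤ B := by
  obtain ⟨B, hB⟩ := (isCompact_range (continuous_proj d hx).abs).bddAbove
  exact ⟨B, fun ω => hB ⟨ω, rfl⟩⟩

theorem proj_eq_sum_add {x : ℝ} (hx : |x| < 1) (ω : ℕ → Fin m) (n : ℕ) :
    proj d x ω = (∑ i : Fin n, d (ω i) * x ^ (i : ℕ)) + x ^ n * proj d x fun k => ω (k + n) := by
  unfold proj seriesSum
  rw [← (summable_proj d hx ω).sum_add_tsum_nat_add n, ← tsum_mul_left, Finset.sum_range]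
  congr 1
  exact tsum_congr fun k => by ring

theorem exists_cover_attractor {γ l : ℝ} (hγ0 : 0 < γ) (hγl : γ < l) (hl1 : l < 1) :
    ∃ C > 0, ∃ R > 0, ∀ n : ℕ, ∃ F : Finset (EuclideanSpace ℝ (Fin 2)),
      attractor d γ l ⊆ ⋃ p ∈ F, Metric.closedBall p (R * γ ^ n) ∧
        (F.card : ℝ) ≤ C * (m * l / γ) ^ n := by
  classical
  have hl0 : 0 < l := hγ0.trans hγl
  have hγ : |γ| < 1 := by rw [abs_of_pos hγ0]; linarith
  have hl : |l| < 1 := by rwa [abs_of_pos hl0]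
  obtain ⟨B₁, hB₁⟩ := exists_abs_proj_le d hγ
  obtain ⟨B₂, hB₂⟩ := exists_abs_proj_le d hl
  set B : ℝ := max 1 (max B₁ B₂) with hB
  have hB1 : 1 ≤ B := le_max_left _ _
  have hBγ (ω) : |proj d γ ω| ≤ B :=
    (hB₁ ω).trans ((le_max_left _ _).trans (le_max_right _ _))
  have hBl (ω) : |proj d l ω| ≤ B :=
    (hB₂ ω).trans ((le_max_right _ _).trans (le_max_right _ _))
  -- Each coordinate of the error is at most Bγ^n, so radius 2Bγ^n suffices. The number of strips is
  -- at most 2B(l/γ)^n + 1 ≤ 3B(l/γ)^n, because B ≥ 1 and γ < l.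
  refine ⟨3 * B, by positivity, 2 * B, by positivity, fun n => ?_⟩
  have hγn : 0 < γ ^ n := by positivity
  have hln : 0 < l ^ n := by positivity
  set J : ℕ := ⌊2 * B * (l / γ) ^ n⌋₊ + 1 with hJ
  set S : ℝ → (Fin n → Fin m) → ℝ := fun x w => ∑ i : Fin n, d (w i) * x ^ (i : ℕ)
  set c : (Fin n → Fin m) × Fin J → EuclideanSpace ℝ (Fin 2) := fun q =>
    !₂[S γ q.1, S l q.1 - l ^ n * B + (q.2 : ℕ) * γ ^ n] with hc
  refine ⟨Finset.univ.image c, ?_, ?_⟩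
  · rintro _ ⟨ω, rfl⟩
    set w : Fin n → Fin m := fun i => ω i
    set u : ℝ := proj d γ fun k => ω (k + n)
    set v : ℝ := proj d l fun k => ω (k + n)
    have hx : proj d γ ω = S γ w + γ ^ n * u := proj_eq_sum_add d hγ ω n
    have hy : proj d l ω = S l w + l ^ n * v := proj_eq_sum_add d hl ω n
    have hu : |u| ≤ B := hBγ _
    have hv := abs_le.1 (hBl fun k => ω (k + n))
    have hz0 : 0 ≤ l ^ n * (v + B) / γ ^ n :=
      div_nonneg (mul_nonneg hln.le (by linarith [hv.1])) hγn.le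
    set j : ℕ := ⌊l ^ n * (v + B) / γ ^ n⌋₊ with hj
    have hjJ : j < J := by
      refine Nat.lt_succ_of_le (Nat.floor_le_floor ?_)
      rw [div_pow, ← mul_div_assoc]
      refine div_le_div_of_nonneg_right ?_ hγn.le
      nlinarith [hv.2]
    have hj1 : j * γ ^ n ≤ l ^ n * (v + B) := (le_div_iff₀ hγn).1 (Nat.floor_le hz0)
    have hj2 : l ^ n * (v + B) < (j + 1) * γ ^ n := (div_lt_iff₀ hγn).1 (Nat.lt_floor_add_one _)
    refine Set.mem_iUnion₂.2 ⟨c (w, ⟨j, hjJ⟩), Finset.mem_image_of_mem _ (Finset.mem_univ _), ?_⟩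
    rw [Metric.mem_closedBall, EuclideanSpace.dist_eq]
    refine Real.sqrt_le_iff.2 ⟨by positivity, ?_⟩
    simp only [Fin.sum_univ_two, hc, Real.dist_eq, sq_abs]
    simp only [Matrix.cons_val_zero, Matrix.cons_val_one, Matrix.cons_val_fin_one]
    rw [hx, hy]
    have e1 : (S γ w + γ ^ n * u - S γ w) ^ 2 ≤ (B * γ ^ n) ^ 2 := by
      rw [add_sub_cancel_left, mul_comm, mul_pow, mul_pow]
      exact mul_le_mul_of_nonneg_right (sq_le_sq' (abs_le.1 hu).1 (abs_le.1 hu).2) (sq_nonneg _)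
    have e2 : (S l w + l ^ n * v - (S l w - l ^ n * B + j * γ ^ n)) ^ 2 ≤ (B * γ ^ n) ^ 2 := by
      have : γ ^ n ≤ B * γ ^ n := le_mul_of_one_le_left hγn.le hB1
      refine sq_le_sq' ?_ ?_ <;> nlinarith
    nlinarith [sq_nonneg (B * γ ^ n)]
  · have hratio : 1 ≤ (l / γ) ^ n := one_le_pow₀ ((one_le_div hγ0).2 hγl.le)
    have hJle : (J : ℝ) ≤ 3 * B * (l / γ) ^ n := by
      rw [hJ]
      push_cast
      have := Nat.floor_le (show 0 ≤ 2 * B * (l / γ) ^ n by positivity)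
      nlinarith
    calc ((Finset.univ.image c).card : ℝ)
        ≤ (Finset.univ : Finset ((Fin n → Fin m) × Fin J)).card := by
          exact_mod_cast Finset.card_image_le
      _ = m ^ n * J := by simp
      _ ≤ m ^ n * (3 * B * (l / γ) ^ n) := mul_le_mul_of_nonneg_left hJle (by positivity)
      _ = _ := by rw [mul_div_assoc, mul_pow]; ring

theorem isCompact_attractor {γ l : ℝ} (hγ : |γ| < 1) (hl : |l| < 1) :
    IsCompact (attractor d γ l) := by
  refine isCompact_range ((PiLp.continuous_toLp 2 _).comp (continuous_pi fun j => ?_))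
  fin_cases j
  · exact continuous_proj d hγ
  · exact continuous_proj d hl

/-- Finite energy of the product kernel yields a measure satisfying Frostman's condition. -/
theorem exists_measure_attractor [NeZero m] {γ l a b : ℝ} (hγ : |γ| < 1) (hl : |l| < 1)
    (ha : 0 < a) (hb : 0 < b)
    (h : ∫⁻ Z, rieszKernel d a γ Z * rieszKernel d b l Z ∂pairMeasure m < ⊤) :
    ∃ ν : Measure (EuclideanSpace ℝ (Fin 2)), ν (attractor d γ l) ≠ 0 ∧
      ν (attractor d γ l) ≠ ⊤ ∧ ∃ M : ℝ≥0, M ≠ 0 ∧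
      ∀ S, ν S ≤ M * Metric.ediam S ^ (a + b) := by
  set Φ : (ℕ → Fin m) → EuclideanSpace ℝ (Fin 2) := fun ω => !₂[proj d γ ω, proj d l ω] with hΦ
  have hΦm : Measurable Φ := by
    refine Continuous.measurable ((PiLp.continuous_toLp 2 _).comp (continuous_pi fun j => ?_))
    fin_cases j
    · exact continuous_proj d hγ
    · exact continuous_proj d hl
  set μ := (uniformBernoulli m).map Φ with hμ
  have : IsProbabilityMeasure μ := Measure.isProbabilityMeasure_map hΦm.aemeasurable
  have hcoord (p q : EuclideanSpace ℝ (Fin 2)) (i : Fin 2) :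
      ENNReal.ofReal |p i - q i| ≤ edist p q := by
    rw [edist_dist]
    refine ENNReal.ofReal_le_ofReal ?_
    rw [dist_eq_norm]
    exact PiLp.norm_apply_le (p - q) i
  have hker (ω ω' : ℕ → Fin m) : edist (Φ ω) (Φ ω') ^ (-(a + b)) ≤
      rieszKernel d a γ (ω, ω') * rieszKernel d b l (ω, ω') := by
    rw [rieszKernel_of_abs_lt hγ, rieszKernel_of_abs_lt hl, diffSeries_eq_sub d hγ,
      diffSeries_eq_sub d hl]
    have h0 : ENNReal.ofReal |proj d γ ω - proj d γ ω'| ≤ edist (Φ ω) (Φ ω') := hcoord _ _ 0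
    have h1 : ENNReal.ofReal |proj d l ω - proj d l ω'| ≤ edist (Φ ω) (Φ ω') := hcoord _ _ 1
    have hanti {x y : ℝ≥0∞} {e : ℝ} (he : 0 < e) (hxy : x ≤ y) : y ^ (-e) ≤ x ^ (-e) := by
      rw [ENNReal.rpow_neg, ENNReal.rpow_neg, ENNReal.inv_le_inv]
      exact ENNReal.rpow_le_rpow hxy he.le
    -- Additivity of exponents fails at base 0 in general; here all exponents are negative and both
    -- sides are ⊤.
    have hsplit : edist (Φ ω) (Φ ω') ^ (-(a + b)) =
        edist (Φ ω) (Φ ω') ^ (-a) * edist (Φ ω) (Φ ω') ^ (-b) := by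
      rcases eq_or_ne (edist (Φ ω) (Φ ω')) 0 with hz | hz
      · rw [hz, ENNReal.zero_rpow_of_neg (by linarith), ENNReal.zero_rpow_of_neg (by linarith),
          ENNReal.zero_rpow_of_neg (by linarith), ENNReal.top_mul_top]
      · rw [neg_add, ENNReal.rpow_add _ _ hz (edist_ne_top _ _)]
    rw [hsplit]
    exact mul_le_mul' (hanti ha h0) (hanti hb h1)
  have hE : ∫⁻ x, ∫⁻ y, edist x y ^ (-(a + b)) ∂μ ∂μ < ⊤ := by
    have hm2 : Measurable fun q : EuclideanSpace ℝ (Fin 2) × EuclideanSpace ℝ (Fin 2) =>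
        edist q.1 q.2 ^ (-(a + b)) := measurable_edist.pow_const _
    rw [hμ, lintegral_map (by rw [← hμ]; exact hm2.lintegral_prod_right') hΦm]
    have hmeas : Measurable fun Z => rieszKernel d a γ Z * rieszKernel d b l Z :=
      (measurable_rieszKernel_right d a γ).mul (measurable_rieszKernel_right d b l)
    rw [pairMeasure, lintegral_prod _ hmeas.aemeasurable] at h
    refine lt_of_le_of_lt (lintegral_mono fun ω => ?_) h
    have hm1 : Measurable fun y => edist (Φ ω) y ^ (-(a + b)) :=
      measurable_edist_right.pow_const _
    rw [lintegral_map hm1 hΦm]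
    exact lintegral_mono fun ω' => hker ω ω'
  obtain ⟨A, hA, hA0, M, hM, hS⟩ := exists_measure_le_ediam_rpow μ (add_pos ha hb) hE
  refine ⟨μ.restrict A, ?_, measure_ne_top _ _, M, hM, hS⟩
  have hK : MeasurableSet (attractor d γ l) := (isCompact_attractor d hγ hl).isClosed.measurableSet
  have hfull : ∀ᵐ x ∂μ, x ∈ attractor d γ l :=
    (ae_map_iff hΦm.aemeasurable hK).2 (ae_of_all _ fun ω => ⟨ω, rfl⟩)
  rw [Measure.restrict_apply hK, measure_congr (t := A)]
  · exact hA0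
  · filter_upwards [hfull] with x hx
    exact propext ⟨fun h => h.2, fun h => ⟨hx, h⟩⟩

end

/-! ### The dimension formula -/

theorem dim_attractor_of_headEnergy {m : ℕ} [NeZero m] (d : Fin m → ℝ) {γ l : ℝ}
    (hp : (γ, l) ∈ regionGamma m 0 (1 / m))
    (hE : ∀ a b : ℚ, 0 < (a : ℝ) → (a : ℝ) < 1 → 0 < (b : ℝ) → (b : ℝ) < 1 →
      headEnergy d a b (γ, l) < ⊤) :
    dimH (attractor d γ l) = ENNReal.ofReal (1 + Real.log (m * l) / Real.log (1 / γ)) ∧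
      HasBoxDim (attractor d γ l) (1 + Real.log (m * l) / Real.log (1 / γ)) := by
  obtain ⟨⟨⟨hγ0, hγ1⟩, ⟨hl0, hl1⟩, hγl, hml⟩, -, hγlm⟩ := hp
  simp only at hγ0 hγ1 hl0 hl1 hγl hml hγlm
  have hm0 : (0 : ℝ) < m := by exact_mod_cast NeZero.pos m
  have hml1 : 1 < m * l := by rwa [div_lt_iff₀' hm0] at hml
  have hm1 : 1 < m := by
    have : (1 : ℝ) < m := by nlinarith
    exact_mod_cast this
  have hγ : |γ| < 1 := by rwa [abs_of_pos hγ0]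
  have hl : |l| < 1 := by rwa [abs_of_pos hl0]
  set θ : ℝ := Real.log (m * l) / Real.log (1 / γ) with hθ
  have hlogγ : 0 < Real.log (1 / γ) := Real.log_pos ((one_lt_div hγ0).2 hγ1)
  have hθ0 : 0 < θ := div_pos (Real.log_pos hml1) hlogγ
  have hθ1 : θ < 1 := by
    rw [hθ, div_lt_one hlogγ]
    refine Real.log_lt_log (by positivity) ?_
    rw [lt_div_iff₀ hm0] at hγlm
    rw [lt_div_iff₀ hγ0]
    linarith
  have hγθ : γ ^ (-θ) = m * l := by
    rw [Real.rpow_def_of_pos hγ0, ← neg_mul_comm, ← Real.log_inv, ← one_div, hθ,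
      mul_div_cancel₀ _ hlogγ.ne', Real.exp_log (by positivity)]
  have hmeasure : ∀ t < 1 + θ, ∃ u > t, 0 < u ∧ ∃ ν : Measure (EuclideanSpace ℝ (Fin 2)),
      ν (attractor d γ l) ≠ 0 ∧ ν (attractor d γ l) ≠ ⊤ ∧ ∃ M : ℝ≥0, M ≠ 0 ∧
        ∀ S, ν S ≤ M * Metric.ediam S ^ u := by
    intro t ht
    -- Exponents within δ of θ and of 1 lose less than 2δ in total, so their sum exceeds t. They are
    -- rational so that countably many null sets cover all choices.
    set δ := (1 + θ - t) / 2 with hδ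
    have hδ0 : 0 < δ := by linarith
    obtain ⟨a, ha1, ha2⟩ := exists_rat_btwn (max_lt (by linarith : θ - δ < θ) hθ0)
    obtain ⟨b, hb1, hb2⟩ := exists_rat_btwn (max_lt (by linarith : 1 - δ < 1) one_pos)
    rw [max_lt_iff] at ha1 hb1
    refine ⟨a + b, by linarith [ha1.1, hb1.1], by linarith [ha1.2, hb1.2], ?_⟩
    refine exists_measure_attractor d hγ hl ha1.2 hb1.2 ?_
    refine lintegral_rieszKernel_mul_lt_top d hγ0 hγ1 hl0 hl1 hm1
      (hE a b ha1.2 (ha2.trans hθ1) hb1.2 hb2) ?_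
    have h1 : γ ^ (-(a : ℝ)) < m * l := by
      rw [← hγθ]
      exact Real.rpow_lt_rpow_of_exponent_gt hγ0 hγ1 (by linarith)
    have h2 : l ^ (-(b : ℝ)) < l⁻¹ := by
      rw [← Real.rpow_neg_one]
      exact Real.rpow_lt_rpow_of_exponent_gt hl0 hl1 (by linarith)
    calc γ ^ (-(a : ℝ)) * l ^ (-(b : ℝ)) < m * l * l⁻¹ :=
          mul_lt_mul'' h1 h2 (by positivity) (by positivity)
      _ = m := mul_inv_cancel_right₀ hl0.ne' _
  obtain ⟨C, hC, r, hr, hcov⟩ := exists_cover_attractor d hγ0 hγl hl1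
  -- This identity converts the count of balls at level n into a power of the scale, and it fixes 1
  -- + θ as the dimension.
  have hpow (n : ℕ) : (γ ^ n) ^ (-(1 + θ)) = (m * l / γ) ^ n := by
    rw [← Real.rpow_natCast, ← Real.rpow_mul hγ0.le, mul_comm, Real.rpow_mul hγ0.le,
      Real.rpow_natCast, neg_add_rev, Real.rpow_add hγ0, hγθ, Real.rpow_neg_one, div_eq_mul_inv]
  simp only [← hpow] at hcov
  constructor
  · refine le_antisymm (dimH_le_of_covers (by linarith) hγ0 hγ1 hr hcov) ?_
    by_contra! hlt
    have hfin : dimH (attractor d γ l) ≠ ⊤ := hlt.ne_top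
    have hlt' : (dimH (attractor d γ l)).toReal < 1 + θ := by
      rwa [ENNReal.lt_ofReal_iff_toReal_lt hfin] at hlt
    obtain ⟨u, hu, hu0, ν, hν, -, M, hM, hS⟩ := hmeasure _ hlt'
    have := ENNReal.toReal_mono hfin (le_dimH_of_measure_le_ediam_rpow hu0.le hM hS hν)
    rw [ENNReal.toReal_ofReal hu0.le] at this
    linarith
  · obtain ⟨C', hC', hup⟩ := exists_externalCoveringNumber_le (by linarith) hγ0 hγ1 hr hC hcov
    refine hasBoxDim_of_bounds (isCompact_attractor d hγ hl).totallyBounded hC' hr hup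
      fun t ht => ?_
    obtain ⟨u, hu, hu0, ν, hν, hνfin, M, hM, hS⟩ := hmeasure t ht
    exact ⟨u, hu, exists_le_externalCoveringNumber hu0 hM hS hν hνfin⟩

end SelfAffine

/-! ### Assembly over the two parts of the parameter set -/

theorem mainTheorem3 (m : ℕ) [NeZero m] (d : Fin m → ℝ) (hd : StrictMono d) (hd0 : d 0 = 0)
    (I J : Set ℝ) (R : Set (ℝ × ℝ))
    (hIopen : IsOpen I) (hIconn : I.OrdConnected) (hIsub : I ⊆ Set.Ioo (1 / (m : ℝ)) 1)
    (hI : ∀ᵐ l : ℝ, l ∈ I →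
      SelfAffine.lowerCorrelationDim (SelfAffine.selfSimilarMeasure d l) = 1)
    (hJopen : IsOpen J) (hJconn : J.OrdConnected) (hJsub : J ⊆ Set.Ioo 0 1)
    (hJ : ∀ c ∈ SelfAffine.powerSeriesClass d, ∀ x ∈ J, ¬ SelfAffine.IsDoubleRoot c x)
    (hRopen : IsOpen R)
    (hR : ∀ p ∈ R, ∀ c ∈ SelfAffine.powerSeriesClass d,
      ¬ (SelfAffine.IsDoubleRoot c p.1 ∧ SelfAffine.IsDoubleRoot c p.2)) :
    ∀ᵐ p : ℝ × ℝ,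
      p ∈ (R ∩ (I ×ˢ I) ∩ SelfAffine.regionGamma m 0 (1 / m)) ∪
          ((J ×ˢ I) ∩ SelfAffine.regionGamma m 0 (1 / m)) →
        dimH (SelfAffine.attractor d p.1 p.2) =
            ENNReal.ofReal (1 + Real.log (m * p.2) / Real.log (1 / p.1)) ∧
          SelfAffine.HasBoxDim (SelfAffine.attractor d p.1 p.2)
            (1 + Real.log (m * p.2) / Real.log (1 / p.1)) := by
  have hIsub' : I ⊆ Set.Ioo 0 1 := hIsub.trans (Set.Ioo_subset_Ioo_left (by positivity))
  have habs {x : ℝ} (hx : x ∈ Set.Ioo (0 : ℝ) 1) : |x| < 1 := by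
    rw [abs_of_pos hx.1]
    exact hx.2
  -- Head energies are finite for all exponents below 1; the constraint a < θ, which depends on p,
  -- enters only after the null set has been fixed.
  have h1 : ∀ᵐ p : ℝ × ℝ, ∀ a b : ℚ, 0 < (a : ℝ) → (a : ℝ) < 1 → 0 < (b : ℝ) → (b : ℝ) < 1 →
      p ∈ R ∩ (I ×ˢ I) → SelfAffine.headEnergy d a b p < ⊤ := by
    simp only [ae_all_iff, Filter.eventually_imp_distrib_left]
    intro a b ha ha1 hb hb1
    refine SelfAffine.ae_headEnergy_lt_top d ha ha1 hb hb1 hIopen.measurableSet hIsub' hI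
      (fun p hp => hp.2.2) True (fun _ p hp => hp.2.1) (fun p hp => habs (hIsub' hp.2.1))
      (fun p hp => habs (hIsub' hp.2.2)) fun p hp Z hZ => ?_
    have := hR p hp.1 _ (SelfAffine.coefDiff_mem_powerSeriesClass d hd hZ)
    tauto
  have h2 : ∀ᵐ p : ℝ × ℝ, ∀ a b : ℚ, 0 < (a : ℝ) → (a : ℝ) < 1 → 0 < (b : ℝ) → (b : ℝ) < 1 →
      p ∈ J ×ˢ I → SelfAffine.headEnergy d a b p < ⊤ := by
    simp only [ae_all_iff, Filter.eventually_imp_distrib_left]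
    intro a b ha ha1 hb hb1
    refine SelfAffine.ae_headEnergy_lt_top d ha ha1 hb hb1 hIopen.measurableSet hIsub' hI
      (fun p hp => hp.2) False (fun h => h.elim) (fun p hp => habs (hJsub hp.1))
      (fun p hp => habs (hIsub' hp.2)) fun p hp Z hZ => ?_
    exact Or.inl (hJ _ (SelfAffine.coefDiff_mem_powerSeriesClass d hd hZ) _ hp.1)
  filter_upwards [h1, h2] with p hp1 hp2 hp
  rcases hp with ⟨hpS, hpΓ⟩ | ⟨hpS, hpΓ⟩
  · exact SelfAffine.dim_attractor_of_headEnergy d hpΓ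
      fun a b ha ha1 hb hb1 => hp1 a b ha ha1 hb hb1 hpS
  · exact SelfAffine.dim_attractor_of_headEnergy d hpΓ
      fun a b ha ha1 hb hb1 => hp2 a b ha ha1 hb hb1 hpS
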